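/- Let $n\ge 0$, $0<q\le 1$ and $t>0$. **Conventions.** A plane tree is a rooted unlabeled tree in which the children of every node are linearly ordered from left to right; a plane forest $F$ is a finite sequence $T_1,\dots,T_m$ of plane trees (its components), and $k(F)=m$. The degree of a node is its number of children. The degree sequence of a plane tree lists the degrees of its nodes in depth-first order (a node comes before its descendants, and these before its siblings to the right); it ends with a $0$. The reduced degree sequence $(d_1,\dots,d_{n+1-m})$ of a plane forest on $n+1$ nodes is obtained by erasing this last $0$ from the degree sequence of each $T_i$ and concatenating the results. Let $a_j$ be the number of nodes of $T_j$, and write $\binom{n}{d_1,d_2,\ldots}=\frac{n!}{d_1!\,d_2!\cdots}$ (the $d_i$ may add up to less than $n$). **The map $\Psi$.** Let $\mathcal G_{n+1}$ be the set of simple graphs on the nodes $1,\dots,n+1$. For $G\in\mathcal G_{n+1}$, order the components so that their maximal labels decrease, and in each component run the neighbors-first search: start with the node of maximal label as the active node; at each step visit the unvisited neighbors of the active node in decreasing order of their labels (they become its children), and make the one with the smallest label the new active node; if there is none, the last visited node that has not been active becomes active. Ordering the children of each node by increasing labels from left to right and erasing the labels gives the plane forest $\Psi(G)$ on $n+1$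 nodes. Let $k(G)$ be the number of connected components of $G$, let $|E(G)|$ be its number of edges, and put $$\mathrm Z_{G}(q,t)=\sum_{H\subseteq G}q^{k(H)-k(G)}t^{|E(H)|},$$ the sum being over all spanning subgraphs $H$ of $G$. **The polytopes.** For a plane tree $T$ on $N+1$ nodes, attach to each node a coordinate $x_i/(1+t)^j$: the root gets $x_0$, and if a node with coordinate $x_i/(1+t)^j$ has the children $v_1,\dots,v_k$ from left to right, then $v_k,v_{k-1},\dots,v_1$ get $x_{i'}/(1+t)^{j},\,x_{i'+1}/(1+t)^{j+1},\dots,x_{i'+k-1}/(1+t)^{j+k-1}$, where the index is the position in the order in which the nodes are visited: when a node becomes active its children are visited from right to left, and then the child visited last becomes active (if there is none, the last visited node that has not been active). Let $\mathbf D_T(t)\subset\mathbb R^N$ be defined by the inequalities $$1\le \frac{x_{i+k-1}}{(1+t)^{j+k-1}}\le\dots\le\frac{x_{i+1}}{(1+t)^{j+1}}\le\frac{x_i}{(1+t)^j}\le 1+t,$$ one chain for each node with children of coordinates $x_i/(1+t)^j,\dots,x_{i+k-1}/(1+t)^{j+k-1}$, $k\geq 1$. For $P\subset\mathbb R^N$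 let $$\mathrm{cone}_q(P)=\{(x_0,x_1,\dots,x_N): 1-q\le x_0\le 1,\ q(x_1,\dots,x_N)\in (x_0-1+q)P+(1-q)(1-x_0)(1,\dots,1)\},$$ and for a plane forest $F$ on $n+1$ nodes with components $T_1,T_2,\dots,T_m$ let $$\mathbf D_F(q,t)=\mathbf D_{T_1}(t)\times\mathrm{cone}_q\bigl(\mathbf D_{T_2}(t)\times\mathrm{cone}_q(\mathbf D_{T_3}(t)\times\cdots)\bigr)\subset\mathbb R^n .$$ The Tutte polytope $\mathbf T_n(q,t)\subset\mathbb R^n$ is defined, with $x_0=1$, by $x_n\ge 1-q$ and $$q x_i\le q(1+t)x_{i-1}-t(1-q)(1-x_{j-1})\qquad(1\le j\le i\le n).$$ **Theorem.** For every plane forest $F$ on $n+1$ nodes with $m$ components, the set $\mathbf D_F(q,t)$ is a bounded polytope (a bounded finite intersection of closed half-spaces), and $$n!\,\mathrm{vol}\,\mathbf D_F(q,t)=\sum_{G\in\mathcal G_{n+1},\ \Psi(G)=F}q^{k(G)-1}t^{|E(G)|} =\frac{\binom{n}{d_1,d_2,\ldots}}{\prod_{j=2}^m(a_j+\dots+a_m)}\;q^{k(F)-1}\,t^{\sum_{i=1}^{n+1-m}d_i}\,(1+t)^{\binom{n+2-m}{2}-\sum_{i=1}^{n+1-m}i\,d_i}.$$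 Furthermore, the polytopes $\mathbf D_F(q,t)$, where $F$ runs over all plane forests on $n+1$ nodes, form a polytopal subdivision of the Tutte polytope $\mathbf T_n(q,t)$: they are finitely many $n$-dimensional polytopes with union $\mathbf T_n(q,t)$ and pairwise disjoint interiors, and any two of them meet in a (possibly empty) common face. In particular, $$n!\,\mathrm{vol}\,\mathbf T_n(q,t)=\sum_{G\in\mathcal G_{n+1}}q^{k(G)-1}t^{|E(G)|}=\mathrm Z_{K_{n+1}}(q,t).$$ -/

import Mathlib

/-! ### Plane forests -/

/-- Plane (ordered, unlabeled, rooted) forests: finite sequences, from left to right, of plane trees.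
A plane tree is a root together with the plane forest formed by the subtrees at the children of the
root. `nil` is the empty sequence; `cons c r` is the forest whose left-most tree consists of a root
with the subtrees `c`, and whose other trees, from left to right, form `r`. -/
inductive PlaneForest : Type
  | nil : PlaneForest
  | cons (c r : PlaneForest) : PlaneForest
  deriving DecidableEq

namespace PlaneForest

/-- The number of nodes. -/
def numNodes : PlaneForest → ℕ
  | nil => 0
  | cons c r => c.numNodes + r.numNodes + 1

/-- The number of components (trees). If the forest is formed by the subtrees at the children of a
node `v`, this is the degree (the number of successors) of `v`. -/
def numTrees : PlaneForest → ℕ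
  | nil => 0
  | cons _ r => r.numTrees + 1

/-- The numbers of nodes `a₁, …, a_m` of the components, from left to right. -/
def treeSizes : PlaneForest → List ℕ
  | nil => []
  | cons c r => (c.numNodes + 1) :: r.treeSizes

/-- The degrees (numbers of successors) of all nodes, in depth-first order, the left-most tree
first. -/
def degSeq : PlaneForest → List ℕ
  | nil => []
  | cons c r => c.numTrees :: (c.degSeq ++ r.degSeq)

/-- The reduced degree sequence: concatenate the degree sequences of the components, after erasing
from each of them its last entry (the zero that marks the end of the component). -/
def reducedDegSeq : PlaneForest → List ℕ
  | nil => []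
  | cons c r => (c.numTrees :: c.degSeq).dropLast ++ r.reducedDegSeq

end PlaneForest

/-! ### Neighbors-first search -/

/-- Labeled forests with an order on their nodes: as `PlaneForest`, but each root carries a label. -/
inductive LabeledForest (V : Type*) : Type _
  | nil : LabeledForest V
  | cons (v : V) (c r : LabeledForest V) : LabeledForest V

namespace LabeledForest

/-- The set of labels that occur. -/
def labels {V : Type*} [DecidableEq V] : LabeledForest V → Finset V
  | nil => ∅
  | cons v c r => insert v (c.labels ∪ r.labels)

/-- Erase the labels. -/
def erase {V : Type*} : LabeledForest V → PlaneForest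
  | nil => PlaneForest.nil
  | cons _ c r => PlaneForest.cons c.erase r.erase

end LabeledForest

section NFS

variable {V : Type*} [Fintype V] [LinearOrder V]

open Classical in
/-- The neighbors of `v` that are not in the set `vis` of visited nodes, in increasing order. -/
noncomputable def unvisitedNeighbors (G : SimpleGraph V) (v : V) (vis : Finset V) : List V :=
  (Finset.univ.filter fun w => G.Adj v w ∧ w ∉ vis).sort (· ≤ ·)

/-- The neighbors-first search. Here `vis` is the set of all visited nodes, and `todo` lists those
visited nodes that have not been active yet, the one visited last coming first. The head `v` of
`todo` becomes active: all its unvisited neighbors are visited in decreasing order of their labels,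
so that the one with the smallest label is the next active node; they become the children of `v`,
ordered increasingly from left to right. When everything reached from them has been processed (this
yields the forest `c` below `v`), the search backtracks to the last visited node that has not been
active, which is the head of `vs`. -/
noncomputable def nfs (G : SimpleGraph V) (todo : List V) (vis : Finset V) : LabeledForest V :=
  match todo with
  | [] => LabeledForest.nil
  | v :: vs =>
    let new := unvisitedNeighbors G v vis
    let c := nfs G new (vis ∪ new.toFinset)
    LabeledForest.cons v c (nfs G vs (vis ∪ c.labels))
termination_by (Finset.univ \ vis).card + todo.length
decreasing_by
  · have hlen : (unvisitedNeighbors G v vis).toFinset.card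
        = (unvisitedNeighbors G v vis).length :=
      List.toFinset_card_of_nodup (Finset.sort_nodup _ _)
    have hdisj : Disjoint vis (unvisitedNeighbors G v vis).toFinset := by
      rw [Finset.disjoint_left]
      intro w hw hw'
      simp [unvisitedNeighbors] at hw'
      exact hw'.2 hw
    have h1 := Finset.card_union_of_disjoint hdisj
    have h2 := Finset.card_sdiff_add_card_eq_card (Finset.subset_univ vis)
    have h3 := Finset.card_sdiff_add_card_eq_card
      (Finset.subset_univ (vis ∪ (unvisitedNeighbors G v vis).toFinset))
    simp only [List.length_cons]
    omega
  · refine Nat.add_lt_add_of_le_of_lt (Finset.card_le_card ?_) (by simp)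
    exact Finset.sdiff_subset_sdiff (Finset.Subset.refl _) Finset.subset_union_left

open Classical in
/-- The nodes whose label is maximal in their connected component. -/
noncomputable def componentMaxima (G : SimpleGraph V) : Finset V :=
  Finset.univ.filter fun v => ∀ w, G.Reachable v w → w ≤ v

/-- The search forest `Φ(G)`: the components of `G` are ordered so that their maximal labels
decrease, and the neighbors-first search is performed on each component, starting at the node with
the maximal label. (Marking the starting nodes of all components as visited at the outset has no
effect on the search in the other components.) -/
noncomputable def searchForest (G : SimpleGraph V) : LabeledForest V :=
  nfs G ((componentMaxima G).sort (· ≥ ·)) (componentMaxima G)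

/-- The plane forest `Ψ(G)`, obtained from `Φ(G)` by erasing the labels. -/
noncomputable def planeSearchForest (G : SimpleGraph V) : PlaneForest :=
  (searchForest G).erase

end NFS

/-! ### Graph statistics -/

/-- The number `k(G)` of connected components. -/
noncomputable def numComponents {V : Type*} (G : SimpleGraph V) : ℕ := Nat.card G.ConnectedComponent

/-- The number of edges. -/
noncomputable def numEdges {V : Type*} (G : SimpleGraph V) : ℕ := G.edgeSet.ncard

open Classical in
/-- The polynomial `Z_G(q, t) = ∑_{H ⊆ G} q ^ (k(H) - k(G)) t ^ e(H)`, the sum being over all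
spanning subgraphs `H` of `G`. -/
noncomputable def clusterPolynomial {V : Type*} [Fintype V] (G : SimpleGraph V) (q t : ℝ) : ℝ :=
  ∑ H ∈ Finset.univ.filter (fun H : SimpleGraph V => H ≤ G),
    q ^ (numComponents H - numComponents G) * t ^ numEdges H

/-! ### Polytopes -/

/-- The coordinates `x₁, …, x_n` of a point of `ℝⁿ`, together with `x₀ = 1`. -/
def coord {n : ℕ} (x : Fin n → ℝ) : ℕ → ℝ
  | 0 => 1
  | i + 1 => if h : i < n then x ⟨i, h⟩ else 0

/-- A finite intersection of closed half-spaces `a₁ x₁ + ⋯ + a_n x_n ≤ b`. -/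
def IsPolyhedron {n : ℕ} (P : Set (Fin n → ℝ)) : Prop :=
  ∃ H : Finset ((Fin n → ℝ) × ℝ), P = {x | ∀ h ∈ H, ∑ i, h.1 i * x i ≤ h.2}

/-- A bounded finite intersection of closed half-spaces. -/
def IsBoundedPolytope {n : ℕ} (P : Set (Fin n → ℝ)) : Prop :=
  IsPolyhedron P ∧ Bornology.IsBounded P

/-- The sets `D i` form a polytopal subdivision of `P ⊆ ℝⁿ`: they are finitely many
`n`-dimensional bounded polytopes with union `P` and with pairwise disjoint interiors, and any two
of them meet in a (possibly empty) common face. -/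
structure IsPolytopalSubdivision {n : ℕ} {ι : Type*} (P : Set (Fin n → ℝ))
    (D : ι → Set (Fin n → ℝ)) : Prop where
  finite : Finite ι
  isBoundedPolytope : ∀ i, IsBoundedPolytope (D i)
  interior_nonempty : ∀ i, (interior (D i)).Nonempty
  iUnion_eq : ⋃ i, D i = P
  disjoint_interior : ∀ i j, i ≠ j → Disjoint (interior (D i)) (interior (D j))
  isExposed_inter : ∀ i j, IsExposed ℝ (D i) (D i ∩ D j) ∧ IsExposed ℝ (D j) (D i ∩ D j)

/-- The Tutte polytope `T_n(q, t)`. -/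
def tuttePolytope (n : ℕ) (q t : ℝ) : Set (Fin n → ℝ) :=
  {x | 1 - q ≤ coord x n ∧ ∀ i j : ℕ, 1 ≤ j → j ≤ i → i ≤ n →
    q * coord x i ≤ q * (1 + t) * coord x (i - 1) - t * (1 - q) * (1 - coord x (j - 1))}

/-- The direct product `P × Q ⊆ ℝ^(a+b)` of `P ⊆ ℝ^a` and `Q ⊆ ℝ^b`. -/
def directProduct {a b : ℕ} (P : Set (Fin a → ℝ)) (Q : Set (Fin b → ℝ)) : Set (Fin (a + b) → ℝ) :=
  {x | (fun i => x (Fin.castAdd b i)) ∈ P ∧ (fun i => x (Fin.natAdd a i)) ∈ Q}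

/-- The `q`-cone of `P ⊆ ℝ^k`: the points `(x₀, …, x_k)` such that `1 - q ≤ x₀ ≤ 1` and
`q (x₁, …, x_k) ∈ (x₀ - 1 + q) P + (1 - q) (1 - x₀)`. -/
def coneQ (q : ℝ) {k : ℕ} (P : Set (Fin k → ℝ)) : Set (Fin (k + 1) → ℝ) :=
  {x | 1 - q ≤ x 0 ∧ x 0 ≤ 1 ∧
    ∃ p ∈ P, ∀ i : Fin k, q * x i.succ = (x 0 - 1 + q) * p i + (1 - q) * (1 - x 0)}

namespace PlaneForest

/-- Coordinates of the successors of the nodes of a plane tree. Let `F` be the forest of the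
subtrees at the children of a node with coordinate `x_i / (1 + t) ^ j`, and let `p` be the position
of the node that is visited next after these children. The children get the exponents
`j, j + 1, …` from right to left, so the exponent of each of them is `j` plus the number of its
siblings to the right. The children of a node are visited one after the other from right to left,
then the search proceeds with the left-most one, and the descendants of a node are visited before
those of its siblings to the right.
The result lists, for all nodes of `F`, the triple `(i, j, k)`, where `k` is the number of
successors of the node and these have, from right to left, the coordinates
`x_i / (1 + t) ^ j, x_{i+1} / (1 + t) ^ (j+1), …, x_{i+k-1} / (1 + t) ^ (j+k-1)`. -/
def successorBlocks : PlaneForest → ℕ → ℕ → List (ℕ × ℕ × ℕ)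
  | nil, _, _ => []
  | cons c r, p, j =>
    (p, j + r.numTrees, c.numTrees) ::
      (c.successorBlocks (p + c.numTrees) (j + r.numTrees) ++
        r.successorBlocks (p + c.numNodes) j)

/-- The blocks `(i, j, k)` for all nodes of the plane tree whose root has the subtrees `c`, the root
(with coordinate `x_0 / (1 + t) ^ 0`) included. -/
def treeBlocks (c : PlaneForest) : List (ℕ × ℕ × ℕ) :=
  (1, 0, c.numTrees) :: c.successorBlocks (1 + c.numTrees) 0

/-- The polytope `D_T(t)` of the plane tree `T` whose root has the subtrees `c` (so that `T` has
`c.numNodes + 1` nodes): for each node, with successors of coordinates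
`x_i / (1 + t) ^ j, …, x_{i+k-1} / (1 + t) ^ (j+k-1)`, take the inequalities
`1 ≤ x_{i+k-1} / (1 + t) ^ (j+k-1) ≤ ⋯ ≤ x_i / (1 + t) ^ j ≤ 1 + t`. -/
def treePolytope (t : ℝ) (c : PlaneForest) : Set (Fin c.numNodes → ℝ) :=
  {x | ∀ i j k : ℕ, (i, j, k) ∈ c.treeBlocks →
    (∀ m < k, 1 ≤ coord x (i + m) / (1 + t) ^ (j + m) ∧
      coord x (i + m) / (1 + t) ^ (j + m) ≤ 1 + t) ∧
    (∀ m, m + 1 < k →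
      coord x (i + (m + 1)) / (1 + t) ^ (j + (m + 1)) ≤ coord x (i + m) / (1 + t) ^ (j + m))}

/-- For the trees `T₂, T₃, …` of a forest, `cone_q(D_{T₂}(t) × cone_q(D_{T₃}(t) × ⋯))`. If there are
no trees, this is `ℝ⁰`, so that it contributes nothing to a direct product. -/
def conePart (q t : ℝ) : (F : PlaneForest) → Set (Fin F.numNodes → ℝ)
  | nil => Set.univ
  | cons c r => coneQ q (directProduct (c.treePolytope t) (r.conePart q t))

/-- `D_F(q, t) = D_{T₁}(t) × cone_q(D_{T₂}(t) × cone_q(D_{T₃}(t) × ⋯))`, a subset of `ℝ^(N-1)` for a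
plane forest with `N` nodes. (For the empty forest, which is of no interest, this is `ℝ⁰`.) -/
def polytope (q t : ℝ) : (F : PlaneForest) → Set (Fin (F.numNodes - 1) → ℝ)
  | nil => Set.univ
  | cons c r => directProduct (c.treePolytope t) (r.conePart q t)

end PlaneForest

/-- Plane forests with `N` nodes. -/
abbrev PlaneForestOn (N : ℕ) : Type := {F : PlaneForest // F.numNodes = N}

/-- `D_F(q, t)`, as a subset of `ℝⁿ`, for a plane forest with `n + 1` nodes. -/
def forestPolytope {n : ℕ} (q t : ℝ) (F : PlaneForestOn (n + 1)) : Set (Fin n → ℝ) :=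
  {x | (fun i => x (Fin.cast (by rw [F.2, Nat.add_sub_cancel]) i)) ∈ F.1.polytope q t}

/-! Both sides are controlled by one code of a forest. List the nodes in the order of the visits,
writing 0 for the root of a component and otherwise the exponent of the node plus one. The sequences
that arise are exactly those that start with 0 and rise by at most one at each step
(`codeTop_injective`, `exists_codeTop_eq`).

Geometry: put Y_i = x_i - (1-q). The q-cone becomes a genuine scaling, and the first tree has scale
Y_0 = q. Within a component of scale ρ, a code g confines q·Y_i to the interval from `low g`·ρ to
`lev g`·ρ, and a code 0 makes Y_i the new scale. These intervals for g = 0, 1, 2, … are adjacent and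
tile the half-line when ρ > 0. A code 0 gives a value at most ρ and a positive code gives a value at
least ρ, so the scale is always the minimum of the preceding Y_j. The Tutte inequalities read q·Y_i
≤ q(1+t)·Y_{i-1} + t(1-q)·Y_{j-1}, so for each i they amount to the single one in which the minimal
Y_{j-1}, that is ρ, occurs. By `lev_succ` this inequality carries the upper wall of code f to the
upper wall of code f+1. So codes of points of the Tutte polytope rise by at most one, and the
inequality says more than the walls only for consecutive siblings, where it is the chain inequality
of the tree polytope. Hence D_F is the set of points of the Tutte polytope in the box of the code of
F (`reg_iff_box_and_tutteCond`), and these boxes cover it (`exists_box`). Two such cells meet where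
one affine function, nonnegative on the first, vanishes: the total distance to the walls shared with
the other box (`slack`). This gives common faces and disjoint interiors.

Volume: integrating one coordinate at a time (`volume_reg`), a non-root of exponent j contributes
its interval length, proportional to t(1+t)^j. A block of k siblings gives 1/k! because their
normalized positions decrease, and a cone gives the reciprocal of its dimension.

Graphs: the search is a stack process. When a node becomes active with s other nodes waiting and u
unvisited, its d children can be chosen in binom(u,d) ways, with weight t^d, and the edges to the
waiting nodes are free, with weight (1+t)^s (`sum_graphsOn_run`). The number s is the exponent of
the node. Thus both computations give the same product over nodes, and double counting against the
degree sequence turns the sum of the exponents into the stated power of 1+t. -/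

/-! ### Combinatorics of plane forests -/

/-- Lists in which every entry exceeds its predecessor by at most one, where `b` precedes the first
entry. -/
def Climb : ℕ → List ℕ → Prop
  | _, [] => True
  | b, a :: l => a ≤ b + 1 ∧ Climb a l

theorem Climb.mono {b b' : ℕ} (h : b ≤ b') : ∀ {l : List ℕ}, Climb b l → Climb b' l
  | [], _ => trivial
  | _ :: _, hl => ⟨hl.1.trans (by omega), hl.2⟩

/-- The entry before the junction is `b` or lies in `l₁`, so it is at least `j`, and whatever may
follow `j` may follow it. -/
theorem Climb.append {j : ℕ} {l₂ : List ℕ} (h₂ : Climb j l₂) :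
    ∀ {l₁ : List ℕ} {b : ℕ}, j ≤ b → Climb b l₁ → (∀ a ∈ l₁, j ≤ a) → Climb b (l₁ ++ l₂)
  | [], _, hb, _, _ => h₂.mono hb
  | a :: l₁, _, _, h₁, hj =>
    ⟨h₁.1, Climb.append h₂ (hj a (by simp)) h₁.2 fun x hx => hj x (by simp [hx])⟩

theorem Climb.of_append_left {l₂ : List ℕ} :
    ∀ {l₁ : List ℕ} {b : ℕ}, Climb b (l₁ ++ l₂) → Climb b l₁
  | [], _, _ => trivial
  | _ :: _, _, h => ⟨h.1, Climb.of_append_left h.2⟩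

theorem Climb.exists_of_append_right {l₂ : List ℕ} :
    ∀ {l₁ : List ℕ} {b : ℕ}, Climb b (l₁ ++ l₂) → ∃ b', Climb b' l₂
  | [], b, h => ⟨b, h⟩
  | _ :: _, _, h => Climb.exists_of_append_right h.2

theorem Climb.of_head_le {j b : ℕ} : ∀ {l : List ℕ}, Climb b l → (∀ a ∈ l.head?, a ≤ j + 1) →
    Climb j l
  | [], _, _ => trivial
  | a :: _, hl, h => ⟨h a (by simp), hl.2⟩

namespace PlaneForest

/-! ### Degree sequences determine plane forests -/

theorem numTrees_le_numNodes : ∀ F : PlaneForest, F.numTrees ≤ F.numNodes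
  | nil => le_rfl
  | cons c r => by have := numTrees_le_numNodes r; simp only [numTrees, numNodes]; omega

theorem length_degSeq : ∀ F : PlaneForest, F.degSeq.length = F.numNodes
  | nil => rfl
  | cons c r => by
    simp only [degSeq, numNodes, List.length_cons, List.length_append, length_degSeq c,
      length_degSeq r]

theorem sum_degSeq_add_numTrees : ∀ F : PlaneForest, F.degSeq.sum + F.numTrees = F.numNodes
  | nil => rfl
  | cons c r => by
    have h₁ := sum_degSeq_add_numTrees c
    have h₂ := sum_degSeq_add_numTrees r
    simp only [degSeq, numNodes, numTrees, List.sum_cons, List.sum_append]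
    omega

/-- Once the number of trees is known, the end of a degree sequence can be recognized: the first
entry gives the number of subtrees below the first root, and the argument recurses. -/
theorem degSeq_append_inj : ∀ {F F' : PlaneForest} {l l' : List ℕ}, F.numTrees = F'.numTrees →
    F.degSeq ++ l = F'.degSeq ++ l' → F = F' ∧ l = l'
  | nil, nil, _, _, _, h => ⟨rfl, h⟩
  | nil, cons _ _, _, _, h, _ => by simp [numTrees] at h
  | cons _ _, nil, _, _, h, _ => by simp [numTrees] at h
  | cons c r, cons c' r', l, l', h, hl => by
    simp only [degSeq, List.cons_append, List.append_assoc, List.cons.injEq] at hl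
    obtain ⟨rfl, h₂⟩ := degSeq_append_inj hl.1 hl.2
    obtain ⟨rfl, h₃⟩ := degSeq_append_inj (by simpa [numTrees] using h) h₂
    exact ⟨rfl, h₃⟩

theorem degSeq_injective : Function.Injective degSeq := by
  intro F
  induction F with
  | nil => intro F' h; cases F' with
    | nil => rfl
    | cons c r => simp [degSeq] at h
  | cons c r _ ihr => intro F' h; cases F' with
    | nil => simp [degSeq] at h
    | cons c' r' =>
      simp only [degSeq, List.cons.injEq] at h
      obtain ⟨rfl, h₂⟩ := degSeq_append_inj h.1 h.2
      rw [ihr h₂]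

theorem finite_numNodes_le (N : ℕ) : {F : PlaneForest | F.numNodes ≤ N}.Finite := by
  induction N with
  | zero =>
    refine (Set.finite_singleton nil).subset fun F hF => ?_
    cases F with
    | nil => rfl
    | cons c r => simp [numNodes] at hF
  | succ N ih =>
    refine ((Set.finite_singleton nil).union (ih.image2 cons ih)).subset fun F hF => ?_
    cases F with
    | nil => exact Or.inl rfl
    | cons c r =>
      simp only [numNodes, Set.mem_ofPred_eq] at hF
      exact Or.inr ⟨c, by simp only [Set.mem_ofPred_eq]; omega, r,
        by simp only [Set.mem_ofPred_eq]; omega, rfl⟩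

/-! #### The codes of plane forests -/

/-- The exponents of the proper descendants of the roots, in the order of the visits, if the roots
have, from right to left, the exponents `j, j + 1, …`. -/
def descCode : PlaneForest → ℕ → List ℕ
  | nil, _ => []
  | cons c r, j =>
    List.range' (j + r.numTrees) c.numTrees ++ (c.descCode (j + r.numTrees) ++ r.descCode j)

/-- The exponents of all nodes, in the order of the visits. -/
def code (F : PlaneForest) (j : ℕ) : List ℕ := List.range' j F.numTrees ++ F.descCode j

/-- The exponents, raised by one, of all nodes that are not roots, and zero for the roots. -/
def codeTop : PlaneForest → List ℕ
  | nil => []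
  | cons c r => 0 :: (c.code 1 ++ r.codeTop)

/-- Add the tree whose root has the subtrees `c` on the right. -/
def snoc : PlaneForest → PlaneForest → PlaneForest
  | nil, c => cons c nil
  | cons a r, c => cons a (snoc r c)

theorem numTrees_snoc (c : PlaneForest) : ∀ F : PlaneForest, (snoc F c).numTrees = F.numTrees + 1
  | nil => rfl
  | cons a r => by simp [snoc, numTrees, numTrees_snoc c r]

theorem numNodes_snoc (c : PlaneForest) :
    ∀ F : PlaneForest, (snoc F c).numNodes = F.numNodes + c.numNodes + 1
  | nil => by simp [snoc, numNodes]
  | cons a r => by simp only [snoc, numNodes, numNodes_snoc c r]; omega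

theorem exists_eq_snoc : ∀ c r : PlaneForest, ∃ F a, cons c r = snoc F a
  | c, nil => ⟨nil, c, rfl⟩
  | c, cons c' r => by
    obtain ⟨F, a, h⟩ := exists_eq_snoc c' r
    exact ⟨cons c F, a, by rw [h, snoc]⟩

/-- Siblings are visited from right to left, so codes decompose at the right-most tree, while the
constructor `cons` splits off the left-most one. -/
theorem snoc_induction {motive : PlaneForest → Prop} (nil : motive nil)
    (snoc : ∀ F c, motive F → motive c → motive (snoc F c)) (F : PlaneForest) : motive F := by
  suffices ∀ N, ∀ F : PlaneForest, F.numNodes < N → motive F from this _ F (Nat.lt_succ_self _)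
  intro N
  induction N with
  | zero => intro F hF; omega
  | succ N ih =>
    intro F hF
    cases F with
    | nil => exact nil
    | cons c r =>
      obtain ⟨F, a, h⟩ := exists_eq_snoc c r
      rw [h] at hF ⊢
      rw [numNodes_snoc] at hF
      exact snoc F a (ih F (by omega)) (ih a (by omega))

theorem descCode_snoc (c : PlaneForest) :
    ∀ (F : PlaneForest) (j : ℕ), (snoc F c).descCode j = F.descCode (j + 1) ++ c.code j
  | nil, j => by simp [snoc, descCode, code, numTrees]
  | cons a r, j => by
    have h : j + (r.numTrees + 1) = j + 1 + r.numTrees := by omega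
    simp only [snoc, descCode, numTrees_snoc, descCode_snoc c r, h, List.append_assoc]

/-- The right-most root is visited first, but its descendants come after everything in the other
trees. Its children start again at the exponent `j`, since it has no siblings to its right. -/
theorem code_snoc (F c : PlaneForest) (j : ℕ) :
    (snoc F c).code j = j :: (F.code (j + 1) ++ c.code j) := by
  simp [code, numTrees_snoc, List.range'_succ, descCode_snoc]

theorem code_nil (j : ℕ) : nil.code j = [] := by simp [code, numTrees, descCode]

theorem le_of_mem_code (F : PlaneForest) : ∀ {j a : ℕ}, a ∈ F.code j → j ≤ a := by
  induction F using snoc_induction with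
  | nil => intro j a h; simp [code_nil] at h
  | snoc F c ihF ihc =>
    intro j a h
    rw [code_snoc, List.mem_cons, List.mem_append] at h
    rcases h with rfl | h | h
    · exact le_rfl
    · have := ihF h; omega
    · exact ihc h

theorem head_code (F : PlaneForest) {j a : ℕ} (h : a ∈ (F.code j).head?) : a = j := by
  induction F using snoc_induction with
  | nil => simp [code_nil] at h
  | snoc F c ihF ihc => simpa [code_snoc, eq_comm] using h

theorem climb_code (F : PlaneForest) : ∀ j, Climb j (F.code j) := by
  induction F using snoc_induction with
  | nil => intro j; simp [code_nil, Climb]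
  | snoc F c ihF ihc =>
    intro j
    rw [code_snoc]
    refine ⟨Nat.le_succ j, Climb.append (ihc j) le_rfl ?_ fun a ha => ?_⟩
    · exact (ihF (j + 1)).of_head_le fun a ha => (F.head_code ha).le
    · have := F.le_of_mem_code ha; omega

theorem length_descCode : ∀ (F : PlaneForest) (j : ℕ),
    (F.descCode j).length = F.numNodes - F.numTrees
  | nil, _ => rfl
  | cons c r, j => by
    have h₁ := c.numTrees_le_numNodes
    have h₂ := r.numTrees_le_numNodes
    simp only [descCode, List.length_append, List.length_range', length_descCode c,
      length_descCode r, numNodes, numTrees]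
    omega

theorem length_code (F : PlaneForest) (j : ℕ) : (F.code j).length = F.numNodes := by
  have := F.numTrees_le_numNodes
  simp only [code, List.length_append, List.length_range', length_descCode]
  omega

theorem length_codeTop : ∀ F : PlaneForest, F.codeTop.length = F.numNodes
  | nil => rfl
  | cons c r => by simp [codeTop, length_code, length_codeTop r, numNodes]

theorem head_codeTop (F : PlaneForest) {a : ℕ} (h : a ∈ F.codeTop.head?) : a = 0 := by
  cases F with
  | nil => simp [codeTop] at h
  | cons c r => simpa [codeTop, eq_comm] using h

theorem climb_codeTop : ∀ F : PlaneForest, Climb 0 F.codeTop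
  | nil => trivial
  | cons c r => ⟨Nat.zero_le _, Climb.append (climb_codeTop r) le_rfl
      ((c.climb_code 1).of_head_le fun _ ha => (c.head_code ha).le) fun _ _ => Nat.zero_le _⟩

theorem takeWhile_dropWhile_of_lt {j : ℕ} {l₁ l₂ : List ℕ} (h₁ : ∀ a ∈ l₁, j < a)
    (h₂ : ∀ a ∈ l₂.head?, a ≤ j) :
    (l₁ ++ l₂).takeWhile (j < ·) = l₁ ∧ (l₁ ++ l₂).dropWhile (j < ·) = l₂ := by
  have h₁' : ∀ a ∈ l₁, decide (j < a) = true := by simpa using h₁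
  rw [List.takeWhile_append_of_pos h₁', List.dropWhile_append_of_pos h₁']
  cases l₂ with
  | nil => simp
  | cons a l => 
    have : ¬ j < a := by simpa using h₂ a (by simp)
    simp [this]

theorem append_inj_of_lt {j : ℕ} {l₁ l₂ l₁' l₂' : List ℕ} (h₁ : ∀ a ∈ l₁, j < a)
    (h₂ : ∀ a ∈ l₂.head?, a ≤ j) (h₁' : ∀ a ∈ l₁', j < a) (h₂' : ∀ a ∈ l₂'.head?, a ≤ j)
    (h : l₁ ++ l₂ = l₁' ++ l₂') : l₁ = l₁' ∧ l₂ = l₂' := by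
  obtain ⟨h₃, h₄⟩ := takeWhile_dropWhile_of_lt h₁ h₂
  obtain ⟨h₅, h₆⟩ := takeWhile_dropWhile_of_lt h₁' h₂'
  rw [h] at h₃ h₄
  exact ⟨h₃.symm.trans h₅, h₄.symm.trans h₆⟩

/-- After the leading `j`, the part of `F` has entries greater than `j` and the part of `c` starts
with `j`, so the cut in `code_snoc` can be read off from the list. -/
theorem code_injective (F : PlaneForest) :
    ∀ {F' : PlaneForest} {j : ℕ}, F.code j = F'.code j → F = F' := by
  induction F using snoc_induction with
  | nil =>
    intro F' j h
    have := congrArg List.length h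
    simp only [length_code] at this
    cases F' with
    | nil => rfl
    | cons c r => simp [numNodes] at this
  | snoc F c ihF ihc =>
    intro F' j h
    cases F' with
    | nil => simp [code_snoc, code_nil] at h
    | cons c' r' =>
      obtain ⟨F', a, h'⟩ := exists_eq_snoc c' r'
      rw [h'] at h ⊢
      rw [code_snoc, code_snoc, List.cons.injEq] at h
      obtain ⟨h₁, h₂⟩ := append_inj_of_lt (fun _ => F.le_of_mem_code)
        (fun _ h => (c.head_code h).le) (fun _ => F'.le_of_mem_code)
        (fun _ h => (a.head_code h).le) h.2
      rw [ihF h₁, ihc h₂]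

theorem codeTop_injective : Function.Injective codeTop := by
  intro F
  induction F with
  | nil => intro F' h; cases F' with
    | nil => rfl
    | cons c r => simp [codeTop] at h
  | cons c r _ ihr => intro F' h; cases F' with
    | nil => simp [codeTop] at h
    | cons c' r' =>
      simp only [codeTop, List.cons.injEq, true_and] at h
      obtain ⟨h₁, h₂⟩ := append_inj_of_lt (fun _ => c.le_of_mem_code)
        (fun _ h => (r.head_codeTop h).le) (fun _ => c'.le_of_mem_code)
        (fun _ h => (r'.head_codeTop h).le) h
      rw [code_injective _ h₁, ihr h₂]

/-- The cut of `code_snoc` run backwards: after the leading `j`, split at the first entry that is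
not greater than `j`. The climbing condition makes the first piece, if nonempty, start with `j + 1`.
-/
theorem exists_code_eq (n : ℕ) : ∀ {l : List ℕ} {j b : ℕ}, l.length ≤ n → (∀ a ∈ l, j ≤ a) →
    (∀ a ∈ l.head?, a ≤ j) → Climb b l → ∃ F : PlaneForest, F.code j = l := by
  induction n with
  | zero =>
    intro l j b hl _ _ _
    exact ⟨nil, by rw [code_nil, List.length_eq_zero_iff.1 (Nat.le_zero.1 hl)]⟩
  | succ n ih =>
    intro l j b hl hj hh hc
    cases l with
    | nil => exact ⟨nil, code_nil j⟩
    | cons a l =>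
      obtain rfl : a = j := le_antisymm (hh a (by simp)) (hj a (by simp))
      have hsplit := List.takeWhile_append_dropWhile (p := (a < ·)) (l := l)
      have hlen := congrArg List.length hsplit
      simp only [List.length_append, List.length_cons] at hlen hl
      have hc' : Climb a (l.takeWhile (a < ·) ++ l.dropWhile (a < ·)) := by
        rw [hsplit]; exact hc.2
      obtain ⟨b', hb'⟩ := hc'.exists_of_append_right
      obtain ⟨F, hF⟩ := ih (l := l.takeWhile (a < ·)) (j := a + 1) (b := a) (by omega)
        (fun x hx => by simpa using List.mem_takeWhile_imp hx)
        (fun x hx => by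
          have := hc'.of_append_left
          cases h : l.takeWhile (a < ·) with
          | nil => simp [h] at hx
          | cons y l' =>
            rw [h] at hx this
            simp only [List.head?_cons, Option.mem_def, Option.some.injEq] at hx
            exact hx ▸ this.1) hc'.of_append_left
      obtain ⟨c, hc⟩ := ih (l := l.dropWhile (a < ·)) (j := a) (b := b') (by omega)
        (fun x hx => hj x (List.mem_cons_of_mem _ ((List.dropWhile_sublist _).subset hx)))
        (fun x hx => by
          have := List.head?_dropWhile_not (a < ·) l
          rw [Option.mem_def] at hx
          simpa [hx] using this) hb'
      exact ⟨snoc F c, by rw [code_snoc, hF, hc, hsplit]⟩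

theorem exists_codeTop_eq (n : ℕ) : ∀ {l : List ℕ} {b : ℕ}, l.length ≤ n →
    (∀ a ∈ l.head?, a = 0) → Climb b l → ∃ F : PlaneForest, F.codeTop = l := by
  induction n with
  | zero =>
    intro l b hl _ _
    exact ⟨nil, by rw [codeTop, List.length_eq_zero_iff.1 (Nat.le_zero.1 hl)]⟩
  | succ n ih =>
    intro l b hl hh hc
    cases l with
    | nil => exact ⟨nil, rfl⟩
    | cons a l =>
      obtain rfl : a = 0 := hh a (by simp)
      have hsplit := List.takeWhile_append_dropWhile (p := (0 < ·)) (l := l)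
      have hlen := congrArg List.length hsplit
      simp only [List.length_append, List.length_cons] at hlen hl
      have hc' : Climb 0 (l.takeWhile (0 < ·) ++ l.dropWhile (0 < ·)) := by
        rw [hsplit]; exact hc.2
      obtain ⟨b', hb'⟩ := hc'.exists_of_append_right
      obtain ⟨c, hc⟩ := exists_code_eq _ (l := l.takeWhile (0 < ·)) (j := 1) (b := 0) le_rfl
        (fun x hx => by simpa [Nat.one_le_iff_ne_zero, Nat.pos_iff_ne_zero] using
          List.mem_takeWhile_imp hx)
        (fun x hx => by
          have := hc'.of_append_left
          cases h : l.takeWhile (0 < ·) with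
          | nil => simp [h] at hx
          | cons y l' =>
            rw [h] at hx this
            simp only [List.head?_cons, Option.mem_def, Option.some.injEq] at hx
            exact hx ▸ this.1) hc'.of_append_left
      obtain ⟨r, hr⟩ := ih (l := l.dropWhile (0 < ·)) (b := b') (by omega)
        (fun x hx => by
          have := List.head?_dropWhile_not (0 < ·) l
          rw [Option.mem_def] at hx
          simpa [hx] using this) hb'
      exact ⟨cons c r, by rw [codeTop, hc, hr, hsplit]⟩

end PlaneForest

/-! ### The neighbors-first search as a sequential process -/

theorem mem_of_reachable_of_closed {V : Type*} {G : SimpleGraph V} {U : Finset V}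
    (h : ∀ x ∉ U, ∀ y ∈ U, ¬ G.Adj x y) {x w : V} (hx : x ∈ U) (hw : G.Reachable x w) : w ∈ U := by
  obtain ⟨p⟩ := hw
  induction p with
  | nil => exact hx
  | cons hadj p ih =>
    refine ih ?_
    by_contra hn
    exact h _ hn _ hx hadj.symm

open Classical in
/-- The neighbors of `v` in `U`. -/
noncomputable def neighborsIn {V : Type*} (G : SimpleGraph V) (v : V) (U : Finset V) : Finset V :=
  U.filter (G.Adj v)

theorem mem_neighborsIn {V : Type*} {G : SimpleGraph V} {v w : V} {U : Finset V} :
    w ∈ neighborsIn G v U ↔ w ∈ U ∧ G.Adj v w := by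
  simp [neighborsIn]

theorem neighborsIn_subset {V : Type*} (G : SimpleGraph V) (v : V) (U : Finset V) : neighborsIn G v U ⊆ U :=
  fun _ h => (mem_neighborsIn.1 h).1

/-- The neighbors-first search, with the visited but not yet active nodes `todo` of the present
component and the set `U` of unvisited nodes, produces the degrees `ds`. When `todo` is exhausted,
the search goes on with the maximal unvisited node. -/
def Run {V : Type*} [LinearOrder V] (G : SimpleGraph V) : List ℕ → List V → Finset V → Prop
  | [], todo, U => todo = [] ∧ U = ∅
  | d :: ds, v :: vs, U => (neighborsIn G v U).card = d ∧
      Run G ds ((neighborsIn G v U).sort (· ≤ ·) ++ vs) (U \ neighborsIn G v U)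
  | d :: ds, [], U => ∃ h : U.Nonempty,
      (neighborsIn G (U.max' h) (U.erase (U.max' h))).card = d ∧
      Run G ds ((neighborsIn G (U.max' h) (U.erase (U.max' h))).sort (· ≤ ·) ++ [])
        (U.erase (U.max' h) \ neighborsIn G (U.max' h) (U.erase (U.max' h)))

theorem Run.length_eq {V : Type*} [LinearOrder V] {G : SimpleGraph V} : ∀ {ds : List ℕ} {todo : List V} {U : Finset V},
    Run G ds todo U → ds.length = todo.length + U.card
  | [], _, _, h => by simp [h.1, h.2]
  | _ :: ds, v :: vs, U, h => by
    have h₁ := Run.length_eq h.2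
    have h₂ := Finset.card_sdiff_add_card_eq_card (neighborsIn_subset G v U)
    simp only [List.length_append, Finset.length_sort, List.length_cons] at h₁ ⊢
    omega
  | _ :: ds, [], U, ⟨hU, h⟩ => by
    have h₁ := Run.length_eq h.2
    have h₂ := Finset.card_sdiff_add_card_eq_card (neighborsIn_subset G (U.max' hU) (U.erase (U.max' hU)))
    have h₃ := Finset.card_erase_add_one (U.max'_mem hU)
    simp only [List.length_append, Finset.length_sort, List.length_cons, List.length_nil] at h₁ ⊢
    omega

section Search

/-! ### The recursive search is a stack process -/

variable {V : Type*} [Fintype V] [LinearOrder V]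

theorem subset_labels_nfs (G : SimpleGraph V) :
    ∀ (todo : List V) (vis : Finset V), ∀ v ∈ todo, v ∈ (nfs G todo vis).labels
  | [], _, _, h => by simp at h
  | a :: l, vis, v, h => by
    rw [nfs]
    simp only [LabeledForest.labels, Finset.mem_insert, Finset.mem_union]
    rcases List.mem_cons.1 h with rfl | h
    · exact Or.inl rfl
    · exact Or.inr (Or.inr (subset_labels_nfs G l _ v h))

theorem numTrees_erase_nfs (G : SimpleGraph V) :
    ∀ (todo : List V) (vis : Finset V), (nfs G todo vis).erase.numTrees = todo.length
  | [], _ => by rw [nfs]; rfl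
  | a :: l, vis => by
    rw [nfs]
    simp only [LabeledForest.erase, PlaneForest.numTrees, numTrees_erase_nfs G l, List.length_cons]

/-- The recursion treats the list from left to right and passes on only the visited set. The nodes
of `l₁` must be visited already because the set of labels of the search forest also contains them.
-/
theorem degSeq_erase_nfs_append (G : SimpleGraph V) (l₂ : List V) :
    ∀ (l₁ : List V) (vis : Finset V), (∀ v ∈ l₁, v ∈ vis) →
      (nfs G (l₁ ++ l₂) vis).erase.degSeq =
        (nfs G l₁ vis).erase.degSeq ++ (nfs G l₂ (vis ∪ (nfs G l₁ vis).labels)).erase.degSeq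
  | [], vis, _ => by
    have : nfs G [] vis = LabeledForest.nil := by rw [nfs]
    simp [this, LabeledForest.erase, PlaneForest.degSeq, LabeledForest.labels]
  | a :: l, vis, h => by
    rw [List.cons_append, nfs, nfs]
    simp only [LabeledForest.erase, PlaneForest.degSeq, LabeledForest.labels, List.cons_append]
    rw [degSeq_erase_nfs_append G l₂ l _ fun v hv =>
      Finset.mem_union_left _ (h v (List.mem_cons_of_mem _ hv))]
    rw [List.append_assoc]
    congr 6
    ext x
    have := h a (by simp)
    simp only [Finset.mem_union, Finset.mem_insert]
    constructor
    · tauto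
    · rintro (h | rfl | h | h) <;> tauto

/-- Flattens the two recursive calls into one: the new children are pushed on top of the stack.
Hence nodes become active in depth-first order. -/
theorem degSeq_erase_nfs_cons (G : SimpleGraph V) (v : V) (vs : List V) (vis : Finset V) :
    (nfs G (v :: vs) vis).erase.degSeq = (unvisitedNeighbors G v vis).length ::
      (nfs G (unvisitedNeighbors G v vis ++ vs)
        (vis ∪ (unvisitedNeighbors G v vis).toFinset)).erase.degSeq := by
  rw [degSeq_erase_nfs_append _ _ _ _
    (fun x hx => Finset.mem_union_right _ (List.mem_toFinset.2 hx)), nfs]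
  simp only [LabeledForest.erase, PlaneForest.degSeq, numTrees_erase_nfs]
  congr 5
  ext x
  simp only [Finset.mem_union, List.mem_toFinset]
  have := subset_labels_nfs G (unvisitedNeighbors G v vis)
    (vis ∪ (unvisitedNeighbors G v vis).toFinset) x
  tauto

theorem mem_componentMaxima {G : SimpleGraph V} {v : V} :
    v ∈ componentMaxima G ↔ ∀ w, G.Reachable v w → w ≤ v := by
  simp [componentMaxima]

theorem max'_mem_componentMaxima {G : SimpleGraph V} {U : Finset V}
    (h : ∀ x ∉ U, ∀ y ∈ U, ¬ G.Adj x y) (hU : U.Nonempty) : U.max' hU ∈ componentMaxima G :=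
  mem_componentMaxima.2 fun _ hw => U.le_max' _ (mem_of_reachable_of_closed h (U.max'_mem hU) hw)

/-- A set `U` without edges to its complement is a union of components, so its largest element is
the maximum of a component and is the next starting node. -/
theorem sort_componentMaxima_inter {G : SimpleGraph V} {U : Finset V}
    (h : ∀ x ∉ U, ∀ y ∈ U, ¬ G.Adj x y) (hU : U.Nonempty) :
    (componentMaxima G ∩ U).sort (· ≥ ·) =
      U.max' hU :: (componentMaxima G ∩ U.erase (U.max' hU)).sort (· ≥ ·) := by
  have hmem := max'_mem_componentMaxima h hU
  have heq : componentMaxima G ∩ U =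
      insert (U.max' hU) (componentMaxima G ∩ U.erase (U.max' hU)) := by
    ext x
    simp only [Finset.mem_inter, Finset.mem_insert, Finset.mem_erase]
    constructor
    · tauto
    · rintro (rfl | h)
      · exact ⟨hmem, U.max'_mem hU⟩
      · tauto
  rw [heq]
  refine Finset.sort_insert _ (fun b hb => ?_) (by simp)
  exact U.le_max' _ (Finset.mem_of_mem_erase (Finset.mem_inter.1 hb).2)

/-- The hypotheses are the invariants of the search: nodes already processed have no unvisited
neighbors, waiting nodes are visited, and no waiting node is connected to a starting node still in
`U`. The last one makes the premature marking of all starting nodes harmless. -/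
theorem degSeq_nfs_eq_iff_run (G : SimpleGraph V) : ∀ (ds : List ℕ) (todo : List V) (U : Finset V),
    (∀ x ∉ U, x ∉ todo → ∀ y ∈ U, ¬ G.Adj x y) → (∀ v ∈ todo, v ∉ U) →
    (∀ v ∈ todo, ∀ m ∈ componentMaxima G, m ∈ U → ¬ G.Reachable v m) →
    ((nfs G (todo ++ (componentMaxima G ∩ U).sort (· ≥ ·))
      (Uᶜ ∪ componentMaxima G)).erase.degSeq = ds ↔ Run G ds todo U) := by
  have hnil : ∀ vis, (nfs G [] vis).erase.degSeq = [] := fun vis => by rw [nfs]; rfl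
  intro ds
  induction ds with
  | nil =>
    intro todo U h₁ h₂ h₃
    cases todo with
    | cons v vs => simp [degSeq_erase_nfs_cons, Run]
    | nil =>
      simp only [List.nil_append, Run, true_and]
      constructor
      · intro h
        by_contra hU
        have hne := Finset.nonempty_iff_ne_empty.2 hU
        rw [sort_componentMaxima_inter (fun x hx => h₁ x hx (by simp)) hne,
          degSeq_erase_nfs_cons] at h
        simp at h
      · rintro rfl
        simp [hnil]
  | cons d ds ih =>
    have key : ∀ (v : V) (vs : List V) (U : Finset V),
        (∀ x ∉ U, x ∉ v :: vs → ∀ y ∈ U, ¬ G.Adj x y) → (∀ x ∈ v :: vs, x ∉ U) →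
        (∀ x ∈ v :: vs, ∀ m ∈ componentMaxima G, m ∈ U → ¬ G.Reachable x m) →
        ((nfs G (v :: vs ++ (componentMaxima G ∩ U).sort (· ≥ ·))
          (Uᶜ ∪ componentMaxima G)).erase.degSeq = d :: ds ↔ Run G (d :: ds) (v :: vs) U) := by
      intro v vs U h₁ h₂ h₃
      have hnew : unvisitedNeighbors G v (Uᶜ ∪ componentMaxima G) =
          (neighborsIn G v U).sort (· ≤ ·) := by
        rw [unvisitedNeighbors]
        congr 1
        ext w
        simp only [neighborsIn, Finset.mem_filter, Finset.mem_univ, true_and, Finset.mem_union,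
          Finset.mem_compl, not_or, not_not]
        constructor
        · tauto
        · rintro ⟨hw, hvw⟩
          exact ⟨hvw, hw, fun hm => h₃ v (by simp) w hm hw hvw.reachable⟩
      have hdisj : ∀ w ∈ neighborsIn G v U, w ∉ componentMaxima G := fun w hw hm =>
        h₃ v (by simp) w hm (mem_neighborsIn.1 hw).1 (mem_neighborsIn.1 hw).2.reachable
      have hinter : componentMaxima G ∩ U = componentMaxima G ∩ (U \ neighborsIn G v U) := by
        ext w
        have := hdisj w
        simp only [Finset.mem_inter, Finset.mem_sdiff]
        tauto
      have hvis : Uᶜ ∪ componentMaxima G ∪ (neighborsIn G v U) =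
          (U \ neighborsIn G v U)ᶜ ∪ componentMaxima G := by
        ext w
        simp only [Finset.mem_union, Finset.mem_compl, Finset.mem_sdiff]
        tauto
      rw [List.cons_append, degSeq_erase_nfs_cons, hnew, List.cons.injEq, Finset.length_sort,
        Finset.sort_toFinset, hvis, hinter, ← List.append_assoc, Run]
      refine and_congr_right fun _ => ih _ _ ?_ ?_ ?_
      · intro x hx hx' y hy hxy
        simp only [List.mem_append, Finset.mem_sort, not_or] at hx'
        rw [Finset.mem_sdiff] at hx hy
        by_cases hxU : x ∈ U
        · exact hx ⟨hxU, hx'.1⟩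
        · by_cases hxv : x = v
          · subst hxv
            exact hy.2 (by simp [neighborsIn, hxy, hy.1])
          · exact h₁ x hxU (by simp [hxv, hx'.2]) y hy.1 hxy
      · intro x hx
        simp only [List.mem_append, Finset.mem_sort] at hx
        rw [Finset.mem_sdiff]
        rcases hx with hx | hx
        · tauto
        · exact fun h => h₂ x (by simp [hx]) h.1
      · intro x hx m hm hmU hr
        simp only [List.mem_append, Finset.mem_sort] at hx
        rcases hx with hx | hx
        · exact h₃ v (by simp) m hm (Finset.mem_sdiff.1 hmU).1
            ((mem_neighborsIn.1 hx).2.reachable.trans hr)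
        · exact h₃ x (by simp [hx]) m hm (Finset.mem_sdiff.1 hmU).1 hr
    intro todo U h₁ h₂ h₃
    cases todo with
    | cons v vs => exact key v vs U h₁ h₂ h₃
    | nil =>
      rcases U.eq_empty_or_nonempty with rfl | hU
      · simp [hnil, Run]
      · have hcl : ∀ x ∉ U, ∀ y ∈ U, ¬ G.Adj x y := fun x hx => h₁ x hx (by simp)
        have hmem := max'_mem_componentMaxima hcl hU
        have hvis : Uᶜ ∪ componentMaxima G = (U.erase (U.max' hU))ᶜ ∪ componentMaxima G := by
          ext w
          simp only [Finset.mem_union, Finset.mem_compl, Finset.mem_erase]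
          by_cases hw : w = U.max' hU
          · subst hw; tauto
          · tauto
        -- An empty stack is restarted with the largest unvisited node, after which the case of a
        -- nonempty stack applies.
        have hk := key (U.max' hU) [] (U.erase (U.max' hU)) ?_ ?_ ?_
        · rw [List.nil_append, sort_componentMaxima_inter hcl hU, hvis]
          rw [List.cons_append, List.nil_append] at hk
          rw [hk]
          simp only [Run]
          exact ⟨fun h => ⟨hU, h⟩, fun h => h.2⟩
        · intro x hx hx' y hy
          simp only [Finset.mem_erase, not_and, List.mem_singleton] at hx hx'
          exact hcl x (hx hx') y (Finset.mem_of_mem_erase hy)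
        · simp
        · intro x hx m hm hmU hr
          rw [List.mem_singleton] at hx
          subst hx
          have h₄ := mem_componentMaxima.1 hm _ hr.symm
          have h₅ := mem_componentMaxima.1 hmem _ hr
          exact (Finset.mem_erase.1 hmU).1 (le_antisymm h₅ h₄)

theorem planeSearchForest_eq_iff_run (G : SimpleGraph V) (F : PlaneForest) :
    planeSearchForest G = F ↔ Run G F.degSeq [] Finset.univ := by
  have := degSeq_nfs_eq_iff_run G F.degSeq [] Finset.univ (by simp) (by simp) (by simp)
  rw [← this, List.nil_append, Finset.inter_univ, Finset.compl_univ, Finset.empty_union]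
  exact PlaneForest.degSeq_injective.eq_iff.symm

theorem numNodes_planeSearchForest (G : SimpleGraph V) :
    (planeSearchForest G).numNodes = Fintype.card V := by
  have := ((planeSearchForest_eq_iff_run G _).1 rfl).length_eq
  simpa [PlaneForest.length_degSeq] using this

theorem numTrees_planeSearchForest (G : SimpleGraph V) :
    (planeSearchForest G).numTrees = numComponents G := by
  rw [planeSearchForest, searchForest, numTrees_erase_nfs, Finset.length_sort, numComponents,
    ← Fintype.card_coe, ← Nat.card_eq_fintype_card]
  refine Nat.card_eq_of_bijective (fun v => G.connectedComponentMk v.1) ⟨fun v w h => ?_, fun c => ?_⟩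
  · have hr : G.Reachable v.1 w.1 := SimpleGraph.ConnectedComponent.exact h
    exact Subtype.ext (le_antisymm (mem_componentMaxima.1 w.2 _ hr.symm)
      (mem_componentMaxima.1 v.2 _ hr))
  · classical
    induction c using SimpleGraph.ConnectedComponent.ind with
    | _ v =>
      have hne : (Finset.univ.filter fun w => G.Reachable v w).Nonempty := ⟨v, by simp⟩
      have hmem := Finset.max'_mem _ hne
      rw [Finset.mem_filter] at hmem
      refine ⟨⟨_, mem_componentMaxima.2 fun w hw => Finset.le_max' _ w ?_⟩,
        SimpleGraph.ConnectedComponent.sound hmem.2.symm⟩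
      simpa using hmem.2.trans hw

end Search

/-! ### Sums over graphs -/

section GraphSum

variable {V : Type*}

/-- The star with center `v` and leaves `N`. -/
def starGraph (v : V) (N : Finset V) : SimpleGraph V :=
  SimpleGraph.fromRel fun a b => a = v ∧ b ∈ N

theorem starGraph_adj {v : V} {N : Finset V} (hv : v ∉ N) {a b : V} :
    (starGraph v N).Adj a b ↔ (a = v ∧ b ∈ N) ∨ (b = v ∧ a ∈ N) := by
  rw [starGraph, SimpleGraph.fromRel_adj]
  constructor
  · exact fun h => h.2
  · rintro (⟨rfl, h⟩ | ⟨rfl, h⟩)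
    · exact ⟨fun h' => hv (h' ▸ h), Or.inl ⟨rfl, h⟩⟩
    · exact ⟨fun h' => hv (h' ▸ h), Or.inr ⟨rfl, h⟩⟩

/-- The restriction of a graph to the edges inside `A`. -/
def edgesWithin (G : SimpleGraph V) (A : Finset V) : SimpleGraph V where
  Adj a b := G.Adj a b ∧ a ∈ A ∧ b ∈ A
  symm := ⟨fun _ _ h => ⟨h.1.symm, h.2.2, h.2.1⟩⟩
  loopless := ⟨fun _ h => h.1.ne rfl⟩

theorem sum_powerset_union [DecidableEq V] {A B : Finset V} (hAB : Disjoint A B)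
    (h : Finset V → ℝ) :
    ∑ N ∈ (A ∪ B).powerset, h N = ∑ D ∈ A.powerset, ∑ S ∈ B.powerset, h (D ∪ S) := by
  rw [← Finset.sum_product']
  rw [Finset.disjoint_left] at hAB
  refine Finset.sum_bij' (fun N _ => (N ∩ A, N ∩ B)) (fun p _ => p.1 ∪ p.2) ?_ ?_ ?_ ?_ ?_
  · intro N _; simp
  · intro p hp
    rw [Finset.mem_product, Finset.mem_powerset, Finset.mem_powerset] at hp
    exact Finset.mem_powerset.2 (Finset.union_subset_union hp.1 hp.2)
  · intro N hN
    rw [Finset.mem_powerset] at hN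
    simp only [← Finset.inter_union_distrib_left]
    exact Finset.inter_eq_left.2 hN
  · rintro ⟨D, S⟩ hp
    rw [Finset.mem_product, Finset.mem_powerset, Finset.mem_powerset] at hp
    obtain ⟨hD, hS⟩ := hp
    ext x
    · have h₁ := @hD x; have h₂ := @hS x; have h₃ := @hAB x
      simp only [Finset.mem_inter, Finset.mem_union]; tauto
    · have h₁ := @hD x; have h₂ := @hS x; have h₃ := @hAB x
      simp only [Finset.mem_inter, Finset.mem_union]; tauto
  · intro N hN
    rw [Finset.mem_powerset] at hN
    simp only [← Finset.inter_union_distrib_left]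
    rw [Finset.inter_eq_left.2 hN]

theorem neighborsIn_congr {G G' : SimpleGraph V} {v : V} {U : Finset V}
    (h : ∀ w ∈ U, G.Adj v w ↔ G'.Adj v w) : neighborsIn G v U = neighborsIn G' v U := by
  ext w
  rw [mem_neighborsIn, mem_neighborsIn]
  exact and_congr_right (h w)

/-- The search never inspects other edges: neither those between waiting nodes nor those at
processed nodes. -/
theorem Run.congr [LinearOrder V] {G G' : SimpleGraph V} : ∀ {ds : List ℕ} {todo : List V} {U : Finset V},
    (∀ x, x ∈ todo ∨ x ∈ U → ∀ w ∈ U, G.Adj x w ↔ G'.Adj x w) →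
    (Run G ds todo U ↔ Run G' ds todo U)
  | [], _, _, _ => Iff.rfl
  | d :: ds, v :: vs, U, h => by
    rw [Run, Run, ← neighborsIn_congr (h v (by simp))]
    refine and_congr_right fun _ => Run.congr fun x hx w hw => h x ?_ w (Finset.mem_sdiff.1 hw).1
    simp only [List.mem_append, Finset.mem_sort, Finset.mem_sdiff, mem_neighborsIn] at hx
    simp only [List.mem_cons]
    tauto
  | d :: ds, [], U, h => by
    rw [Run, Run]
    refine exists_congr fun hU => ?_
    rw [← neighborsIn_congr (v := U.max' hU) fun w hw =>
      h _ (Or.inr (U.max'_mem hU)) w (Finset.mem_of_mem_erase hw)]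
    refine and_congr_right fun _ => Run.congr fun x hx w hw =>
      h x ?_ w (Finset.mem_of_mem_erase (Finset.mem_sdiff.1 hw).1)
    simp only [List.mem_append, Finset.mem_sort, Finset.mem_sdiff, mem_neighborsIn,
      Finset.mem_erase, List.not_mem_nil] at hx
    tauto

variable [Fintype V]

open Classical in
/-- The graphs all of whose edges have both ends in `A`. -/
noncomputable def graphsOn (A : Finset V) : Finset (SimpleGraph V) :=
  Finset.univ.filter fun G => ∀ a b, G.Adj a b → a ∈ A ∧ b ∈ A

theorem mem_graphsOn {A : Finset V} {G : SimpleGraph V} :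
    G ∈ graphsOn A ↔ ∀ a b, G.Adj a b → a ∈ A ∧ b ∈ A := by
  simp [graphsOn]

theorem graphsOn_univ [DecidableEq V] : graphsOn (Finset.univ : Finset V) = Finset.univ := by
  ext G; simp [mem_graphsOn]

theorem graphsOn_empty : graphsOn (∅ : Finset V) = {⊥} := by
  ext G
  rw [mem_graphsOn, Finset.mem_singleton]
  constructor
  · intro h
    ext a b
    simpa using fun hab => (h a b hab).1
  · rintro rfl; simp

/-- A graph on `insert v A` amounts to an arbitrary neighborhood of `v` in `A` and an arbitrary
graph on `A`. This reveals the edges at the active node and then discards that node. -/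
theorem sum_graphsOn_insert [DecidableEq V] {v : V} {A : Finset V} (hv : v ∉ A)
    (h : SimpleGraph V → ℝ) :
    ∑ G ∈ graphsOn (insert v A), h G =
      ∑ N ∈ A.powerset, ∑ G ∈ graphsOn A, h (G ⊔ starGraph v N) := by
  rw [← Finset.sum_product']
  symm
  have hvN : ∀ N ∈ A.powerset, v ∉ N := fun N hN h => hv (Finset.mem_powerset.1 hN h)
  refine Finset.sum_bij' (fun p _ => p.2 ⊔ starGraph v p.1)
    (fun G _ => (neighborsIn G v A, edgesWithin G A)) ?_ ?_ ?_ ?_ (fun _ _ => rfl)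
  · rintro ⟨N, G⟩ hp
    rw [Finset.mem_product] at hp
    have hN := Finset.mem_powerset.1 hp.1
    rw [mem_graphsOn]
    intro a b hab
    rw [SimpleGraph.sup_adj, starGraph_adj (hvN N hp.1)] at hab
    simp only [Finset.mem_insert]
    rcases hab with hab | ⟨rfl, hb⟩ | ⟨rfl, ha⟩
    · have := mem_graphsOn.1 hp.2 a b hab; tauto
    · exact ⟨Or.inl rfl, Or.inr (hN hb)⟩
    · exact ⟨Or.inr (hN ha), Or.inl rfl⟩
  · intro G hG
    rw [Finset.mem_product]
    exact ⟨Finset.mem_powerset.2 (neighborsIn_subset _ _ _),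
      mem_graphsOn.2 fun a b hab => hab.2⟩
  · rintro ⟨N, G⟩ hp
    rw [Finset.mem_product] at hp
    have hN := Finset.mem_powerset.1 hp.1
    have hG := mem_graphsOn.1 hp.2
    have hvN' := hvN N hp.1
    simp only [Prod.mk.injEq]
    constructor
    · ext w
      rw [mem_neighborsIn, SimpleGraph.sup_adj, starGraph_adj hvN']
      constructor
      · rintro ⟨_, h | h | h⟩
        · exact absurd (hG _ _ h).1 hv
        · exact h.2
        · exact absurd h.2 hvN'
      · exact fun hw => ⟨hN hw, Or.inr (Or.inl ⟨rfl, hw⟩)⟩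
    · ext a b
      change (G ⊔ starGraph v N).Adj a b ∧ a ∈ A ∧ b ∈ A ↔ _
      rw [SimpleGraph.sup_adj, starGraph_adj hvN']
      constructor
      · rintro ⟨h | ⟨rfl, h⟩ | ⟨rfl, h⟩, ha, hb⟩
        · exact h
        · exact absurd ha hv
        · exact absurd hb hv
      · exact fun h => ⟨Or.inl h, hG _ _ h⟩
  · intro G hG
    rw [mem_graphsOn] at hG
    have hvN' : v ∉ neighborsIn G v A := fun h => hv (neighborsIn_subset _ _ _ h)
    ext a b
    simp only [SimpleGraph.sup_adj, starGraph_adj hvN', mem_neighborsIn]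
    change (G.Adj a b ∧ a ∈ A ∧ b ∈ A) ∨ _ ↔ _
    constructor
    · rintro (h | ⟨rfl, h⟩ | ⟨rfl, h⟩)
      · exact h.1
      · exact h.2
      · exact h.2.symm
    · intro h
      have := hG a b h
      simp only [Finset.mem_insert] at this
      by_cases ha : a = v
      · subst ha
        have hb : b ≠ a := h.ne.symm
        exact Or.inr (Or.inl ⟨rfl, by tauto, h⟩)
      · by_cases hb : b = v
        · subst hb
          exact Or.inr (Or.inr ⟨rfl, by tauto, h.symm⟩)
        · exact Or.inl ⟨h, by tauto, by tauto⟩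

theorem numEdges_sup_starGraph {v : V} {A N : Finset V} (hv : v ∉ A) (hN : N ⊆ A)
    {G : SimpleGraph V} (hG : G ∈ graphsOn A) :
    numEdges (G ⊔ starGraph v N) = numEdges G + N.card := by
  have hvN : v ∉ N := fun h => hv (hN h)
  have hstar : (starGraph v N).edgeSet = (fun w => s(v, w)) '' (N : Set V) := by
    ext e
    induction e using Sym2.ind with
    | _ a b =>
      simp only [SimpleGraph.mem_edgeSet, starGraph_adj hvN, Set.mem_image, Finset.mem_coe]
      constructor
      · rintro (⟨rfl, h⟩ | ⟨rfl, h⟩)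
        · exact ⟨b, h, rfl⟩
        · exact ⟨a, h, Sym2.eq_swap⟩
      · rintro ⟨w, hw, h⟩
        rcases Sym2.eq_iff.1 h with ⟨rfl, rfl⟩ | ⟨rfl, rfl⟩
        · exact Or.inl ⟨rfl, hw⟩
        · exact Or.inr ⟨rfl, hw⟩
  rw [numEdges, numEdges, SimpleGraph.edgeSet_sup, Set.ncard_union_eq, hstar,
    Set.ncard_image_of_injective, Set.ncard_coe_finset]
  · intro a b h
    rcases Sym2.eq_iff.1 h with ⟨_, h⟩ | ⟨h₁, h₂⟩
    · exact h
    · exact h₂.trans h₁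
  · rw [Set.disjoint_left]
    intro e he he'
    rw [hstar] at he'
    obtain ⟨w, _, rfl⟩ := he'
    exact hv (mem_graphsOn.1 hG _ _ he).1

variable [LinearOrder V]

/-- The generating function, by the number of edges, of the graphs on `s + u` nodes for which the
search, starting with `s` visited nodes and `u` unvisited nodes, produces the degrees `ds`. -/
noncomputable def runWeight (t : ℝ) : List ℕ → ℕ → ℕ → ℝ
  | [], 0, 0 => 1
  | [], _, _ => 0
  | d :: ds, s + 1, u => u.choose d * t ^ d * (1 + t) ^ s * runWeight t ds (d + s) (u - d)
  | d :: ds, 0, u + 1 => u.choose d * t ^ d * runWeight t ds d (u - d)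
  | _ :: _, 0, 0 => 0

theorem runWeight_zero_succ (t : ℝ) (d : ℕ) (ds : List ℕ) (u : ℕ) :
    runWeight t (d :: ds) 0 (u + 1) = runWeight t (d :: ds) 1 u := by
  simp [runWeight]

-- Remove the active node and split its neighborhood into unvisited neighbors `D` and waiting
-- neighbors `S`. Only `D` influences the search, and it does so only through its size in the count.
-- The free choice of `S` sums to a power of `1 + t`.
open Classical in
theorem sum_graphsOn_run (t : ℝ) : ∀ (ds : List ℕ) (todo : List V) (U : Finset V), todo.Nodup →
    (∀ v ∈ todo, v ∉ U) →
    ∑ G ∈ graphsOn (todo.toFinset ∪ U), (if Run G ds todo U then t ^ numEdges G else 0) =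
      runWeight t ds todo.length U.card := by
  intro ds
  induction ds with
  | nil =>
    intro todo U _ _
    simp only [Run]
    by_cases h : todo = [] ∧ U = ∅
    · obtain ⟨rfl, rfl⟩ := h
      simp [graphsOn_empty, runWeight, numEdges]
    · simp only [h, if_false, Finset.sum_const_zero]
      rw [runWeight]
      intro h₁ h₂
      exact h ⟨List.length_eq_zero_iff.1 h₁, Finset.card_eq_zero.1 h₂⟩
  | cons d ds ih =>
    have key : ∀ (v : V) (vs : List V) (U : Finset V), (v :: vs).Nodup →
        (∀ x ∈ v :: vs, x ∉ U) →
        ∑ G ∈ graphsOn ((v :: vs).toFinset ∪ U),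
          (if Run G (d :: ds) (v :: vs) U then t ^ numEdges G else 0) =
        runWeight t (d :: ds) (vs.length + 1) U.card := by
      intro v vs U hnd hU
      have hvA : v ∉ U ∪ vs.toFinset := by
        simp only [Finset.mem_union, List.mem_toFinset, not_or]
        exact ⟨hU v (by simp), (List.nodup_cons.1 hnd).1⟩
      have hdisj : Disjoint U vs.toFinset := by
        rw [Finset.disjoint_left]
        exact fun x hx hx' => hU x (by simp [List.mem_toFinset.1 hx']) hx
      have hA : (v :: vs).toFinset ∪ U = insert v (U ∪ vs.toFinset) := by
        rw [List.toFinset_cons, Finset.insert_union, Finset.union_comm U]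
      rw [hA, sum_graphsOn_insert hvA, sum_powerset_union hdisj]
      have hterm : ∀ D ∈ U.powerset, ∀ S ∈ vs.toFinset.powerset,
          ∑ G ∈ graphsOn (U ∪ vs.toFinset), (if Run (G ⊔ starGraph v (D ∪ S)) (d :: ds) (v :: vs) U
            then t ^ numEdges (G ⊔ starGraph v (D ∪ S)) else 0) =
          if D.card = d then t ^ d * t ^ S.card * runWeight t ds (d + vs.length) (U.card - d)
            else 0 := by
        intro D hD S hS
        rw [Finset.mem_powerset] at hD hS
        have hDS : Disjoint D S := hdisj.mono hD hS
        have hsub : D ∪ S ⊆ U ∪ vs.toFinset := Finset.union_subset_union hD hS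
        have hv : v ∉ D ∪ S := fun h => hvA (hsub h)
        have hnb : ∀ G ∈ graphsOn (U ∪ vs.toFinset),
            neighborsIn (G ⊔ starGraph v (D ∪ S)) v U = D := by
          intro G hG
          ext w
          rw [mem_neighborsIn, SimpleGraph.sup_adj, starGraph_adj hv]
          constructor
          · rintro ⟨hw, h | h | h⟩
            · exact absurd (mem_graphsOn.1 hG _ _ h).1 hvA
            · rcases Finset.mem_union.1 h.2 with h | h
              · exact h
              · exact absurd (hS h) (Finset.disjoint_left.1 hdisj hw)
            · exact absurd h.2 hv
          · exact fun hw => ⟨hD hw, Or.inr (Or.inl ⟨rfl, Finset.mem_union_left _ hw⟩)⟩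
        -- The star at `v` can be dropped from the rest of the search, since `v` is neither waiting
        -- nor unvisited any more.
        have hrun : ∀ G ∈ graphsOn (U ∪ vs.toFinset),
            (Run (G ⊔ starGraph v (D ∪ S)) (d :: ds) (v :: vs) U ↔
              D.card = d ∧ Run G ds (D.sort (· ≤ ·) ++ vs) (U \ D)) := by
          intro G hG
          rw [Run, hnb G hG]
          refine and_congr_right fun _ => Run.congr fun x hx w hw => ?_
          rw [SimpleGraph.sup_adj, starGraph_adj hv]
          have hxv : x ≠ v := by
            rintro rfl
            simp only [List.mem_append, Finset.mem_sort, Finset.mem_sdiff] at hx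
            rw [Finset.mem_union, List.mem_toFinset] at hvA
            rcases hx with (hx | hx) | hx
            · exact hvA (Or.inl (hD hx))
            · exact hvA (Or.inr hx)
            · exact hvA (Or.inl hx.1)
          have hwv : w ≠ v := by
            rintro rfl
            exact hvA (Finset.mem_union_left _ (Finset.mem_sdiff.1 hw).1)
          simp [hxv, hwv]
        split_ifs with hd
        · have hset : (D.sort (· ≤ ·) ++ vs).toFinset ∪ U \ D = U ∪ vs.toFinset := by
            ext x
            have := @hD x
            simp only [List.toFinset_append, Finset.sort_toFinset, Finset.mem_union,
              Finset.mem_sdiff]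
            tauto
          have := ih (D.sort (· ≤ ·) ++ vs) (U \ D) (by
              refine List.Nodup.append (D.sort_nodup _) (List.nodup_cons.1 hnd).2 ?_
              intro x hx hx'
              exact Finset.disjoint_left.1 hdisj (hD ((Finset.mem_sort _).1 hx))
                (List.mem_toFinset.2 hx')) (by
              intro x hx
              simp only [List.mem_append, Finset.mem_sort] at hx
              rw [Finset.mem_sdiff]
              rcases hx with hx | hx
              · tauto
              · exact fun h => hU x (by simp [hx]) h.1)
          rw [hset, List.length_append, Finset.length_sort, hd, Finset.card_sdiff_of_subset hD,
            hd] at this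
          rw [← this, Finset.mul_sum]
          refine Finset.sum_congr rfl fun G hG => ?_
          rw [if_congr ((hrun G hG).trans (and_iff_right hd)) rfl rfl,
            numEdges_sup_starGraph hvA hsub hG, Finset.card_union_of_disjoint hDS, hd]
          split_ifs
          · ring
          · ring
        · exact Finset.sum_eq_zero fun G hG => if_neg fun h => hd ((hrun G hG).1 h).1
      rw [Finset.sum_congr rfl fun D hD => Finset.sum_congr rfl fun S hS => hterm D hD S hS]
      have hS : ∑ S ∈ vs.toFinset.powerset, t ^ S.card = (1 + t) ^ vs.length := by
        have := Finset.sum_pow_mul_eq_add_pow t 1 vs.toFinset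
        simp only [one_pow, mul_one] at this
        rw [this, List.toFinset_card_of_nodup (List.nodup_cons.1 hnd).2, add_comm]
      have hinner : ∀ D ∈ U.powerset, ∑ S ∈ vs.toFinset.powerset, (if D.card = d then
          t ^ d * t ^ S.card * runWeight t ds (d + vs.length) (U.card - d) else 0) =
          if D.card = d then t ^ d * (1 + t) ^ vs.length *
            runWeight t ds (d + vs.length) (U.card - d) else 0 := by
        intro D _
        split_ifs
        · rw [← Finset.sum_mul, ← Finset.mul_sum, hS]
        · simp
      rw [Finset.sum_congr rfl hinner, ← Finset.sum_filter, Finset.sum_const,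
        ← Finset.powersetCard_eq_filter, Finset.card_powersetCard, nsmul_eq_mul, runWeight]
      ring
    intro todo U hnd hU
    cases todo with
    | cons v vs => exact key v vs U hnd hU
    | nil =>
      rcases U.eq_empty_or_nonempty with rfl | hne
      · simp [Run, runWeight]
      · have hk := key (U.max' hne) [] (U.erase (U.max' hne)) (by simp) (by simp)
        have hset : ([U.max' hne].toFinset ∪ U.erase (U.max' hne)) = [].toFinset ∪ U := by
          ext x
          simp only [List.toFinset_cons, List.toFinset_nil, Finset.mem_union, Finset.mem_insert,
            Finset.mem_erase, Finset.notMem_empty]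
          have := U.max'_mem hne
          by_cases hx : x = U.max' hne
          · subst hx; tauto
          · tauto
        have hc := Finset.card_erase_add_one (U.max'_mem hne)
        rw [hset] at hk
        rw [List.length_nil, ← hc, runWeight_zero_succ]
        refine Eq.trans (Finset.sum_congr rfl fun G _ => if_congr ?_ rfl rfl) hk
        simp only [Run]
        exact ⟨fun h => h.2, fun h => ⟨hne, h⟩⟩

theorem sum_planeSearchForest_eq (q t : ℝ) (F : PlaneForest) :
    ∑ G ∈ Finset.univ.filter (fun G : SimpleGraph V => planeSearchForest G = F),
      q ^ (numComponents G - 1) * t ^ numEdges G =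
    q ^ (F.numTrees - 1) * runWeight t F.degSeq 0 (Fintype.card V) := by
  classical
  have := sum_graphsOn_run t F.degSeq [] (Finset.univ : Finset V) (by simp) (by simp)
  rw [List.toFinset_nil, Finset.empty_union, graphsOn_univ, List.length_nil,
    Finset.card_univ] at this
  rw [← this, Finset.mul_sum, Finset.sum_filter]
  refine Finset.sum_congr rfl fun G _ => ?_
  rw [if_congr (planeSearchForest_eq_iff_run G F) rfl rfl]
  split_ifs with h
  · rw [← numTrees_planeSearchForest, (planeSearchForest_eq_iff_run G F).2 h]
  · simp

end GraphSum

/-! ### The regions described by codes -/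

/-- The upper bound for the quotient of `q (x_p - (1 - q))` and the scale, if the code at `p`
is `f`. -/
def lev (q t : ℝ) (f : ℕ) : ℝ := (1 + t) ^ f - (1 - q)

/-- The lower bound for the quotient of `q (x_p - (1 - q))` and the scale, if the code at `p`
is `f`. -/
def low (q t : ℝ) : ℕ → ℝ
  | 0 => 0
  | f + 1 => lev q t f

/-- The inequalities for the coordinates `Y 1, Y 2, …` with the codes `l`, where `f` and `Y 0` are
the preceding code and coordinate (`f = 0` if no chain can continue), and `ρ` is the scale. -/
def Reg (q t : ℝ) : List ℕ → ℕ → ℝ → (ℕ → ℝ) → Prop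
  | [], _, _, _ => True
  | g :: l, f, ρ, Y => low q t g * ρ ≤ q * Y 1 ∧ q * Y 1 ≤ lev q t g * ρ ∧
      (f ≠ 0 → g = f + 1 → q * Y 1 ≤ q * (1 + t) * Y 0 + t * (1 - q) * ρ) ∧
      Reg q t l g (if g = 0 then Y 1 else ρ) fun i => Y (i + 1)

/-- The walls satisfy the recursion of the Tutte inequality with equality; this is what ties the
codes to that inequality. -/
theorem lev_succ (q t : ℝ) (f : ℕ) : lev q t (f + 1) = (1 + t) * lev q t f + t * (1 - q) := by
  simp only [lev, pow_succ]; ring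

theorem lev_zero (q t : ℝ) : lev q t 0 = q := by simp [lev]

theorem lev_strictMono (q : ℝ) {t : ℝ} (ht : 0 < t) : StrictMono (lev q t) := fun _ _ h =>
  sub_lt_sub_right (pow_lt_pow_right₀ (by linarith) h) _

theorem lev_pos {q t : ℝ} (hq : 0 < q) (ht : 0 < t) (f : ℕ) : 0 < lev q t f :=
  ((lev_zero q t).symm ▸ hq).trans_le ((lev_strictMono q ht).monotone (Nat.zero_le f))

theorem low_nonneg {q t : ℝ} (hq : 0 < q) (ht : 0 < t) : ∀ f, 0 ≤ low q t f
  | 0 => le_rfl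
  | f + 1 => (lev_pos hq ht f).le

theorem low_lt_lev {q t : ℝ} (hq : 0 < q) (ht : 0 < t) : ∀ f, low q t f < lev q t f
  | 0 => lev_pos hq ht 0
  | f + 1 => lev_strictMono q ht (Nat.lt_succ_self f)

section Reg

variable {q t : ℝ}

theorem Reg.congr : ∀ {l : List ℕ} {f : ℕ} {ρ : ℝ} {Y Y' : ℕ → ℝ},
    (f ≠ 0 → Y 0 = Y' 0) → (∀ i < l.length, Y (i + 1) = Y' (i + 1)) →
    (Reg q t l f ρ Y ↔ Reg q t l f ρ Y')
  | [], _, _, _, _, _, _ => Iff.rfl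
  | g :: l, f, ρ, Y, Y', h₀, h => by
    have h₁ : Y 1 = Y' 1 := h 0 (by simp)
    have := Reg.congr (l := l) (f := g) (ρ := if g = 0 then Y 1 else ρ)
      (Y := fun i => Y (i + 1)) (Y' := fun i => Y' (i + 1)) (fun _ => h₁)
      (fun i hi => h (i + 1) (by simpa using hi))
    rw [Reg, Reg, this, h₁]
    by_cases hf : f = 0
    · simp [hf]
    · rw [h₀ hf]

theorem reg_iff_of_head_ne {l : List ℕ} {f : ℕ} (h : ∀ g ∈ l.head?, g ≠ f + 1) (ρ : ℝ)
    (Y : ℕ → ℝ) : Reg q t l f ρ Y ↔ Reg q t l 0 ρ Y := by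
  cases l with
  | nil => rfl
  | cons g l =>
    have : g ≠ f + 1 := h g (by simp)
    simp [Reg, this]

/-- Without a code 0 in `l₁` the scale is unchanged, and a code 0 continues no chain. So a direct
product with the next cone corresponds to concatenation of codes. -/
theorem reg_append {l₂ : List ℕ} (h₂ : ∀ g ∈ l₂.head?, g = 0) :
    ∀ {l₁ : List ℕ} {f : ℕ} {ρ : ℝ} {Y : ℕ → ℝ}, (∀ g ∈ l₁, g ≠ 0) →
    (Reg q t (l₁ ++ l₂) f ρ Y ↔ Reg q t l₁ f ρ Y ∧ Reg q t l₂ 0 ρ fun i => Y (i + l₁.length))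
  | [], f, ρ, Y, _ => by
    rw [List.nil_append, reg_iff_of_head_ne (fun g hg => by rw [h₂ g hg]; omega)]
    simp [Reg]
  | g :: l, f, ρ, Y, h => by
    have hg : g ≠ 0 := h g (by simp)
    rw [List.cons_append, Reg, Reg, reg_append h₂ (fun x hx => h x (List.mem_cons_of_mem _ hx))]
    simp only [hg, if_false, List.length_cons]
    simp only [and_assoc, add_assoc]

theorem reg_smul {s : ℝ} (hs : 0 < s) : ∀ {l : List ℕ} {f : ℕ} {ρ : ℝ} {Y : ℕ → ℝ},
    Reg q t l f (s * ρ) (fun i => s * Y i) ↔ Reg q t l f ρ Y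
  | [], _, _, _ => Iff.rfl
  | g :: l, f, ρ, Y => by
    have h := reg_smul hs (l := l) (f := g) (ρ := if g = 0 then Y 1 else ρ)
      (Y := fun i => Y (i + 1))
    rw [mul_ite] at h
    rw [Reg, Reg, h]
    refine and_congr ?_ (and_congr ?_ (and_congr_left fun _ => forall_congr' fun _ =>
      forall_congr' fun _ => ?_))
    · rw [show low q t g * (s * ρ) = s * (low q t g * ρ) by ring,
        show q * (s * Y 1) = s * (q * Y 1) by ring, mul_le_mul_iff_right₀ hs]
    · rw [show lev q t g * (s * ρ) = s * (lev q t g * ρ) by ring,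
        show q * (s * Y 1) = s * (q * Y 1) by ring, mul_le_mul_iff_right₀ hs]
    · rw [show q * (1 + t) * (s * Y 0) + t * (1 - q) * (s * ρ) =
        s * (q * (1 + t) * Y 0 + t * (1 - q) * ρ) by ring,
        show q * (s * Y 1) = s * (q * Y 1) by ring, mul_le_mul_iff_right₀ hs]

/-- At scale zero all intervals collapse: this is the apex of a cone. -/
theorem reg_zero_iff (hq : 0 < q) : ∀ {l : List ℕ} {f : ℕ} {Y : ℕ → ℝ},
    (f ≠ 0 → Y 0 = 0) → (Reg q t l f 0 Y ↔ ∀ i < l.length, Y (i + 1) = 0)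
  | [], _, _, _ => by simp [Reg]
  | g :: l, f, Y, h => by
    rw [Reg, List.length_cons, Nat.forall_lt_succ_left]
    simp only [mul_zero, zero_add]
    constructor
    · rintro ⟨h₁, h₂, -, h₃⟩
      have hY : Y 1 = 0 := by
        have := le_antisymm h₂ h₁
        simpa [hq.ne'] using this
      rw [hY, ite_self] at h₃
      exact ⟨hY, (reg_zero_iff hq fun _ => hY).1 h₃⟩
    · rintro ⟨hY, h₃⟩
      rw [hY, ite_self]
      refine ⟨by simp, by simp, fun hf _ => by simp [h hf], (reg_zero_iff hq fun _ => hY).2 h₃⟩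

/-- Take every coordinate at its lower wall; the chain inequalities then follow from `lev_succ`.
Nonemptiness of the base is needed for the apex to belong to the cone. -/
theorem exists_reg (hq : 0 < q) : ∀ (l : List ℕ) (f : ℕ) {ρ w : ℝ}, 0 ≤ ρ → 0 < t →
    (f ≠ 0 → low q t f * ρ ≤ q * w) → ∃ Y : ℕ → ℝ, Y 0 = w ∧ Reg q t l f ρ Y
  | [], _, _, w, _, _, _ => ⟨fun _ => w, rfl, trivial⟩
  | g :: l, f, ρ, w, hρ, ht, h => by
    have hdiv : q * (low q t g * ρ / q) = low q t g * ρ := by field_simp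
    have hnn : 0 ≤ low q t g * ρ := mul_nonneg (low_nonneg hq ht g) hρ
    obtain ⟨Y, hY, hr⟩ := exists_reg hq l g (ρ := if g = 0 then low q t g * ρ / q else ρ)
      (w := low q t g * ρ / q) (by split_ifs; exacts [div_nonneg hnn hq.le, hρ]) ht
      (fun hg => by rw [if_neg hg, hdiv])
    refine ⟨fun i => if i = 0 then w else Y (i - 1), rfl, ?_⟩
    simp only [Reg, one_ne_zero, if_false, Nat.sub_self, hY, hdiv, if_true, Nat.add_eq_zero_iff,
      and_false, Nat.add_sub_cancel]
    refine ⟨le_rfl, mul_le_mul_of_nonneg_right (low_lt_lev hq ht g).le hρ, ?_, hr⟩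
    rintro hf rfl
    obtain ⟨f, rfl⟩ := Nat.exists_eq_succ_of_ne_zero hf
    have h₁ := mul_le_mul_of_nonneg_left (h hf) (show 0 ≤ 1 + t by linarith)
    have h₂ := lev_succ q t f
    simp only [low] at h₁ ⊢
    rw [h₂]
    linarith

end Reg

/-! ### The polytopes of forests and the regions -/

/-- The inequalities for the successors of a node. -/
def BlockCond (t : ℝ) (X : ℕ → ℝ) (i j k : ℕ) : Prop :=
  (∀ m < k, 1 ≤ X (i + m) / (1 + t) ^ (j + m) ∧ X (i + m) / (1 + t) ^ (j + m) ≤ 1 + t) ∧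
    ∀ m, m + 1 < k →
      X (i + (m + 1)) / (1 + t) ^ (j + (m + 1)) ≤ X (i + m) / (1 + t) ^ (j + m)

section Blocks

variable {q t : ℝ}

/-- At the scale `q` of the first tree a factor `q` cancels, and the exponent `j` appears as the
code `j + 1`. -/
theorem box_iff (hq : 0 < q) (ht : 0 < t) (a : ℝ) (j : ℕ) :
    (1 ≤ a / (1 + t) ^ j ∧ a / (1 + t) ^ j ≤ 1 + t) ↔
      (low q t (j + 1) * q ≤ q * (a - (1 - q)) ∧ q * (a - (1 - q)) ≤ lev q t (j + 1) * q) := by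
  have hb : 0 < (1 + t) ^ j := by positivity
  rw [one_le_div hb, div_le_iff₀ hb, mul_comm (low q t _), mul_comm (lev q t _),
    mul_le_mul_iff_right₀ hq, mul_le_mul_iff_right₀ hq, low, lev, lev, sub_le_sub_iff_right,
    sub_le_sub_iff_right, pow_succ']

theorem chain_iff (ht : 0 < t) (a b : ℝ) (j : ℕ) :
    b / (1 + t) ^ (j + 1) ≤ a / (1 + t) ^ j ↔ b ≤ (1 + t) * a := by
  have hb : 0 < (1 + t) ^ j := by positivity
  have hb' : 0 < 1 + t := by positivity
  rw [pow_succ, mul_comm, ← div_div, div_le_div_iff_of_pos_right hb, div_le_iff₀ hb', mul_comm a]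

theorem step_iff (hq : 0 < q) (a b : ℝ) :
    q * (b - (1 - q)) ≤ q * (1 + t) * (a - (1 - q)) + t * (1 - q) * q ↔ b ≤ (1 + t) * a := by
  rw [show q * (1 + t) * (a - (1 - q)) + t * (1 - q) * q = q * ((1 + t) * a - (1 - q)) by ring,
    mul_le_mul_iff_right₀ hq, sub_le_sub_iff_right]

/-- Consecutive codes are the siblings of one block, the first of which sits at position `p`. The
condition on the head of `l` ends the chain there. -/
theorem reg_range'_append_of_succ (hq : 0 < q) (ht : 0 < t) {l : List ℕ} {X : ℕ → ℝ} :
    ∀ {k j p : ℕ}, (∀ g ∈ l.head?, g ≠ j + k + 2) →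
    (Reg q t (List.range' (j + 2) k ++ l) (j + 1) q (fun i => X (p + i) - (1 - q)) ↔
      (∀ m < k, 1 ≤ X (p + 1 + m) / (1 + t) ^ (j + 1 + m) ∧
        X (p + 1 + m) / (1 + t) ^ (j + 1 + m) ≤ 1 + t) ∧
      (∀ m < k, X (p + m + 1) / (1 + t) ^ (j + m + 1) ≤ X (p + m) / (1 + t) ^ (j + m)) ∧
      Reg q t l 0 q fun i => X (p + k + i) - (1 - q))
  | 0, j, p, h => by
    rw [List.range'_zero, List.nil_append, reg_iff_of_head_ne h]
    simp
  | k + 1, j, p, h => by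
    have ih := reg_range'_append_of_succ hq ht (l := l) (X := X) (k := k) (j := j + 1) (p := p + 1)
      (fun g hg => by have := h g hg; omega)
    rw [List.range'_succ, List.cons_append, Reg]
    simp only [add_zero, ← add_assoc, add_right_comm _ _ 1] at ih ⊢
    rw [if_neg (by omega), ih, Nat.forall_lt_succ_left, Nat.forall_lt_succ_left, ← and_assoc,
      ← box_iff hq ht, step_iff hq]
    simp only [add_zero, ← add_assoc, add_right_comm _ _ 1]
    rw [chain_iff ht]
    have : j + 2 = j + 1 + 1 := rfl
    simp only [ne_eq, Nat.add_eq_zero_iff, one_ne_zero, and_false, not_false_eq_true, this,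
      forall_const]
    tauto

theorem reg_range'_append (hq : 0 < q) (ht : 0 < t) {l : List ℕ} {X : ℕ → ℝ} {k j p : ℕ}
    (h : k ≠ 0 → ∀ g ∈ l.head?, g ≠ j + k + 1) :
    Reg q t (List.range' (j + 1) k ++ l) 0 q (fun i => X (p + i) - (1 - q)) ↔
      BlockCond t X (p + 1) j k ∧ Reg q t l 0 q fun i => X (p + k + i) - (1 - q) := by
  cases k with
  | zero => simp [BlockCond]
  | succ k =>
    have ih := reg_range'_append_of_succ hq ht (l := l) (X := X) (k := k) (j := j) (p := p + 1)
      (fun g hg => by have := h (by omega) g hg; omega)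
    rw [List.range'_succ, List.cons_append, Reg, BlockCond]
    simp only [← add_assoc, add_right_comm _ _ 1] at ih ⊢
    rw [if_neg (by omega), ih, Nat.forall_lt_succ_left, ← and_assoc, ← box_iff hq ht]
    simp only [add_zero, ← add_assoc, add_right_comm _ _ 1, Nat.add_lt_add_iff_right]
    simp only [ne_eq, not_true_eq_false, false_imp_iff, true_and]
    tauto

end Blocks

namespace PlaneForest

/-- The left-most root has the largest code, and the next node to be visited does not exceed it. So
runs of codes rising by one from a nonzero code stop at the end of each block of siblings. -/
theorem head_descCode_append {L : List ℕ} : ∀ {F : PlaneForest} {j : ℕ}, (∀ g ∈ L.head?, g ≤ j) →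
    ∀ g ∈ (F.descCode j ++ L).head?, g ≤ j + (F.numTrees - 1)
  | nil, j, h, g, hg => (h g (by simpa [descCode] using hg)).trans (by omega)
  | cons c r, j, h, g, hg => by
    cases c with
    | nil =>
      have hr := head_descCode_append (F := r) h g
        (by simpa [descCode, numTrees] using hg)
      simp only [numTrees]; omega
    | cons a b =>
      simp only [descCode, numTrees, List.range'_succ, List.cons_append, List.head?_cons,
        Option.mem_def, Option.some.injEq] at hg ⊢
      omega

theorem zero_notMem_code (F : PlaneForest) : ∀ g ∈ F.code 1, g ≠ 0 := fun g hg => by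
  have := F.le_of_mem_code hg; omega

variable {q t : ℝ}

theorem reg_descCode_append (hq : 0 < q) (ht : 0 < t) (X : ℕ → ℝ) :
    ∀ (F : PlaneForest) {j p : ℕ} {L : List ℕ}, (∀ g ∈ L.head?, g ≤ j + 1) →
    (Reg q t (F.descCode (j + 1) ++ L) 0 q (fun i => X (p + i) - (1 - q)) ↔
      (∀ b ∈ F.successorBlocks (p + 1) j, BlockCond t X b.1 b.2.1 b.2.2) ∧
      Reg q t L 0 q fun i => X (p + (F.numNodes - F.numTrees) + i) - (1 - q))
  | nil, j, p, L, _ => by simp [descCode, successorBlocks, numNodes]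
  | cons c r, j, p, L, h => by
    have h₁ := head_descCode_append (F := r) h
    have h₂ := head_descCode_append (F := c) (j := j + 1 + r.numTrees)
      (fun g hg => (h₁ g hg).trans (by omega))
    have hc := c.numTrees_le_numNodes
    have hr := r.numTrees_le_numNodes
    have e₁ : j + 1 + r.numTrees = j + r.numTrees + 1 := by omega
    rw [e₁] at h₂
    rw [descCode, List.append_assoc, List.append_assoc, e₁,
      reg_range'_append hq ht (fun hk g hg => by have := h₂ g hg; omega),
      reg_descCode_append hq ht X c (fun g hg => (h₁ g hg).trans (by omega)),
      reg_descCode_append hq ht X r h, successorBlocks]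
    have e₂ : p + c.numTrees + (c.numNodes - c.numTrees) = p + c.numNodes := by omega
    have e₃ : p + c.numNodes + (r.numNodes - r.numTrees) =
      p + ((cons c r).numNodes - (cons c r).numTrees) := by simp only [numNodes, numTrees]; omega
    rw [e₂, e₃, add_right_comm p c.numTrees 1, add_right_comm p c.numNodes 1]
    simp only [List.forall_mem_cons, List.forall_mem_append, and_assoc]

theorem mem_treePolytope_iff (hq : 0 < q) (ht : 0 < t) (c : PlaneForest)
    (x : Fin c.numNodes → ℝ) :
    x ∈ c.treePolytope t ↔ Reg q t (c.code 1) 0 q fun i => coord x i - (1 - q) := by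
  have h₁ := reg_range'_append hq ht (l := c.descCode 1) (X := coord x) (k := c.numTrees) (j := 0)
    (p := 0) (fun hk g hg => by
      have := head_descCode_append (F := c) (j := 1) (L := []) (by simp) g (by simpa using hg)
      omega)
  have h₂ := reg_descCode_append hq ht (coord x) c (j := 0) (p := c.numTrees) (L := []) (by simp)
  simp only [zero_add, List.append_nil] at h₁ h₂
  rw [code, h₁, h₂, treePolytope, treeBlocks, add_comm c.numTrees 1]
  simp only [Reg, and_true]
  rw [← List.forall_mem_cons (p := fun b : ℕ × ℕ × ℕ => BlockCond t (coord x) b.1 b.2.1 b.2.2)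
    (a := (1, 0, c.numTrees))]
  exact ⟨fun h b hb => h _ _ _ hb, fun h i j k hb => h (i, j, k) hb⟩

end PlaneForest

theorem coord_castAdd {a b : ℕ} (x : Fin (a + b) → ℝ) {i : ℕ} (hi : i ≤ a) :
    coord (fun j => x (Fin.castAdd b j)) i = coord x i := by
  cases i with
  | zero => rfl
  | succ i =>
    have h : i < a := hi
    have h' : i < a + b := by omega
    simp [coord, h, h', Fin.castAdd, Fin.castLE]

theorem coord_natAdd {a b : ℕ} (x : Fin (a + b) → ℝ) (i : ℕ) :
    coord (fun j => x (Fin.natAdd a j)) (i + 1) = coord x (i + 1 + a) := by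
  have e : i + 1 + a = (i + a) + 1 := by omega
  rw [e]
  simp only [coord]
  by_cases h : i < b
  · have h' : i + a < a + b := by omega
    rw [dif_pos h, dif_pos h']
    congr 1
    ext
    simp [add_comm]
  · rw [dif_neg h, dif_neg (by omega)]

theorem coord_succ {n : ℕ} (x : Fin n → ℝ) {i : ℕ} (h : i < n) : coord x (i + 1) = x ⟨i, h⟩ := by
  simp [coord, h]

namespace PlaneForest

variable {q t : ℝ}

theorem mem_directProduct_iff (hq : 0 < q) (ht : 0 < t) {c r : PlaneForest}
    (hr : ∀ z : Fin r.numNodes → ℝ, z ∈ r.conePart q t ↔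
      Reg q t r.codeTop 0 q fun i => coord z i - (1 - q))
    (x : Fin (c.numNodes + r.numNodes) → ℝ) :
    x ∈ directProduct (c.treePolytope t) (r.conePart q t) ↔
      Reg q t (c.code 1 ++ r.codeTop) 0 q fun i => coord x i - (1 - q) := by
  rw [reg_append (fun _ => r.head_codeTop) c.zero_notMem_code, directProduct]
  refine and_congr ?_ ?_
  · rw [mem_treePolytope_iff hq ht]
    refine Reg.congr (by simp) fun i hi => ?_
    rw [length_code] at hi
    simp only [coord_castAdd x (show i + 1 ≤ c.numNodes from hi)]
  · rw [hr]
    refine Reg.congr (by simp) fun i hi => ?_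
    simp only [coord_natAdd, length_code]

/-- In the coordinates shifted by `1 - q`, the slice of the cone at `x 0` is the base multiplied by
`(x 0 - (1 - q)) / q`, and regions are homogeneous in the scale and the coordinates by `reg_smul`.
-/
theorem mem_coneQ_iff (hq : 0 < q) (ht : 0 < t) {k : ℕ} {l : List ℕ} (hlen : l.length = k)
    {P : Set (Fin k → ℝ)} (hP : ∀ x, x ∈ P ↔ Reg q t l 0 q fun i => coord x i - (1 - q))
    (x : Fin (k + 1) → ℝ) :
    x ∈ coneQ q P ↔ Reg q t (0 :: l) 0 q fun i => coord x i - (1 - q) := by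
  have hx : coord x 1 = x 0 := rfl
  rw [Reg, hx, if_pos rfl]
  simp only [low, lev_zero, zero_mul, ne_eq, not_true_eq_false, false_imp_iff, true_and,
    mul_le_mul_iff_right₀ hq]
  rw [coneQ, Set.mem_ofPred_eq]
  have hq0 : 0 ≤ q * (x 0 - (1 - q)) ↔ 1 - q ≤ x 0 := by
    rw [mul_nonneg_iff_of_pos_left hq, sub_nonneg]
  have hq1 : x 0 - (1 - q) ≤ q ↔ x 0 ≤ 1 := by constructor <;> intro h <;> linarith
  rw [hq0, hq1]
  refine and_congr_right fun h₀ => and_congr_right fun h₁ => ?_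
  have hsucc : ∀ (i : ℕ) (hi : i < k),
      coord x (i + 1 + 1) = x (Fin.succ ⟨i, hi⟩) := fun i hi => coord_succ x (by omega)
  -- The apex is treated separately, because there the point of the base cannot be recovered by
  -- division.
  rcases h₀.eq_or_lt with h₀ | h₀
  · rw [← h₀, sub_self, reg_zero_iff hq (by simp), hlen]
    obtain ⟨Y, -, hY⟩ := exists_reg hq l 0 (w := 0) hq.le ht (by simp)
    have hne : (fun i : Fin k => Y (i + 1) + (1 - q)) ∈ P := by
      rw [hP]
      refine (Reg.congr (by simp) fun i hi => ?_).1 hY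
      rw [hlen] at hi
      simp only [coord_succ _ hi]
      ring
    constructor
    · rintro ⟨p, _, hp⟩ i hi
      have := hp ⟨i, hi⟩
      rw [hsucc i hi]
      have h' : q * (x (Fin.succ ⟨i, hi⟩) - (1 - q)) = 0 := by rw [mul_sub, this]; ring
      exact (mul_eq_zero.1 h').resolve_left hq.ne'
    · intro h
      refine ⟨_, hne, fun i => ?_⟩
      have := h i i.2
      rw [hsucc i i.2] at this
      have h' : x i.succ = 1 - q := by linarith [show x i.succ - (1 - q) = 0 from this]
      rw [h']; ring
  · set s := (x 0 - (1 - q)) / q with hs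
    have hs0 : 0 < s := div_pos (by linarith) hq
    have hx0 : x 0 - (1 - q) = s * q := by rw [hs]; field_simp
    have hscale : ∀ p : Fin k → ℝ,
        (∀ i, q * x i.succ = (x 0 - 1 + q) * p i + (1 - q) * (1 - x 0)) ↔
        ∀ i : Fin k, x i.succ - (1 - q) = s * (p i - (1 - q)) := by
      intro p
      refine forall_congr' fun i => ?_
      have hx0' : x 0 = s * q + (1 - q) := by linarith
      rw [hx0', ← mul_right_inj' hq.ne' (b := x i.succ - (1 - q))]
      constructor <;> intro h <;> linarith
    have hreg : ∀ p : Fin k → ℝ,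
        (∀ i : Fin k, x i.succ - (1 - q) = s * (p i - (1 - q))) →
        ((p ∈ P) ↔ Reg q t l 0 (x 0 - (1 - q))
          fun i => coord x (i + 1) - (1 - q)) := by
      intro p hp
      rw [hP, ← reg_smul hs0, hx0]
      refine Reg.congr (by simp) fun i hi => ?_
      rw [hlen] at hi
      simp only [hsucc i hi, coord_succ _ hi, hp]
    constructor
    · rintro ⟨p, hpP, hp⟩
      exact (hreg p ((hscale p).1 hp)).1 hpP
    · intro h
      have hp : ∀ i : Fin k, x i.succ - (1 - q) =
          s * (((x i.succ - (1 - q)) / s + (1 - q)) - (1 - q)) := by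
        intro i; field_simp; ring
      exact ⟨fun i => (x i.succ - (1 - q)) / s + (1 - q), (hreg _ hp).2 h, (hscale _).2 hp⟩

theorem mem_conePart_iff (hq : 0 < q) (ht : 0 < t) : ∀ (F : PlaneForest) (x : Fin F.numNodes → ℝ),
    x ∈ F.conePart q t ↔ Reg q t F.codeTop 0 q fun i => coord x i - (1 - q)
  | nil, x => by simp [conePart, codeTop, Reg]
  | cons c r, x => mem_coneQ_iff hq ht (by rw [List.length_append, length_code, length_codeTop])
      (mem_directProduct_iff hq ht (c := c) (mem_conePart_iff hq ht r)) x

end PlaneForest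

theorem mem_forestPolytope_iff {q t : ℝ} (hq : 0 < q) (ht : 0 < t) {n : ℕ}
    (F : PlaneForestOn (n + 1)) (x : Fin n → ℝ) :
    x ∈ forestPolytope q t F ↔ Reg q t F.1.codeTop.tail 0 q fun i => coord x i - (1 - q) := by
  obtain ⟨F, hF⟩ := F
  cases F with
  | nil => simp [PlaneForest.numNodes] at hF
  | cons c r =>
    obtain rfl : c.numNodes + r.numNodes = n := by simpa [PlaneForest.numNodes] using hF
    exact PlaneForest.mem_directProduct_iff hq ht (PlaneForest.mem_conePart_iff hq ht r) x

/-! ### Codes as a subdivision -/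

/-- The bounds imposed by the codes `l`. -/
def Box (q t : ℝ) : List ℕ → ℝ → (ℕ → ℝ) → Prop
  | [], _, _ => True
  | g :: l, ρ, Y => (low q t g * ρ ≤ q * Y 1 ∧ q * Y 1 ≤ lev q t g * ρ) ∧
      Box q t l (if g = 0 then Y 1 else ρ) fun i => Y (i + 1)

/-- The inequalities of the Tutte polytope for `Y 1, …, Y n`, where `ρ` is the minimum of the
preceding coordinates and `Y 0` is the last one of them. -/
def TutteCond (q t : ℝ) : ℕ → ℝ → (ℕ → ℝ) → Prop
  | 0, _, _ => True
  | n + 1, ρ, Y => (0 ≤ Y 1 ∧ q * Y 1 ≤ q * (1 + t) * Y 0 + t * (1 - q) * ρ) ∧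
      TutteCond q t n (min ρ (Y 1)) fun i => Y (i + 1)

/-- The contribution of one coordinate `a` to `slack`. -/
def slackTerm (q t : ℝ) (g g' : ℕ) (ρ a : ℝ) : ℝ :=
  if g = g' then 0 else if g + 1 = g' then lev q t g * ρ - q * a
    else if g = g' + 1 then q * a - lev q t g' * ρ else ρ

/-- A linear function that is nonnegative on the box of `l` and vanishes exactly at the points that
also belong to the box of `l'`. -/
def slack (q t : ℝ) : List ℕ → List ℕ → ℝ → (ℕ → ℝ) → ℝ
  | g :: l, g' :: l', ρ, Y =>
    slackTerm q t g g' ρ (Y 1) +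
      slack q t l l' (if g = 0 then Y 1 else ρ) fun i => Y (i + 1)
  | _, _, _, _ => 0

/-- The possible values of the preceding coordinate `w` if the preceding code is `f` and the scale
is `ρ`. -/
def InBox (q t : ℝ) (f : ℕ) (ρ w : ℝ) : Prop :=
  0 ≤ ρ ∧ low q t f * ρ ≤ q * w ∧ q * w ≤ lev q t f * ρ ∧ (f = 0 → w = ρ)

section Box

variable {q t : ℝ}

/-- All positive codes lie above the wall `lev 0 = q`, so a coordinate falls below the scale only
with code 0. Hence the scale is a running minimum and does not depend on which admissible code was
chosen. -/
theorem inBox_step (hq : 0 < q) (ht : 0 < t) {g : ℕ} {ρ a : ℝ} (hρ : 0 ≤ ρ)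
    (h₁ : low q t g * ρ ≤ q * a) (h₂ : q * a ≤ lev q t g * ρ) :
    InBox q t g (if g = 0 then a else ρ) a ∧ (if g = 0 then a else ρ) = min ρ a := by
  rcases Nat.eq_zero_or_pos g with rfl | hg
  · simp only [low, lev_zero, zero_mul] at h₁ h₂
    have ha : 0 ≤ a := nonneg_of_mul_nonneg_right h₁ hq
    have ha' : a ≤ ρ := le_of_mul_le_mul_left h₂ hq
    simp [InBox, low, lev_zero, ha, ha', mul_nonneg hq.le ha]
  · obtain ⟨g, rfl⟩ := Nat.exists_eq_add_of_lt hg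
    simp only [zero_add] at h₁ h₂ ⊢
    have h₃ : q * ρ ≤ q * a := by
      refine le_trans (mul_le_mul_of_nonneg_right ?_ hρ) h₁
      have := (lev_strictMono q ht).monotone (Nat.zero_le g)
      rwa [lev_zero] at this
    simp [InBox, hρ, h₁, h₂, le_of_mul_le_mul_left h₃ hq]

/-- If no chain continues, the upper wall already implies the Tutte inequality: for positive `f` the
lower wall of code `f` is carried to the upper wall of code `f`. For `f = 0` one has `w = ρ`, and
the inequality is the upper wall of code 1. -/
theorem le_of_inBox (ht : 0 < t) {f g : ℕ} {ρ w : ℝ} (hw : InBox q t f ρ w)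
    (hg : g ≤ f + 1) (hf : f ≠ 0 → g ≠ f + 1) {a : ℝ} (h : q * a ≤ lev q t g * ρ) :
    q * a ≤ q * (1 + t) * w + t * (1 - q) * ρ := by
  obtain ⟨hρ, h₁, -, h₃⟩ := hw
  rcases Nat.eq_zero_or_pos f with rfl | hf'
  · rw [h₃ rfl]
    refine h.trans ((mul_le_mul_of_nonneg_right
      ((lev_strictMono q ht).monotone hg) hρ).trans_eq ?_)
    rw [lev_succ, lev_zero]; ring
  · obtain ⟨k, rfl⟩ := Nat.exists_eq_add_of_lt hf'
    have hgf : g ≤ k + 1 := by have := hf (by omega); omega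
    refine h.trans ((mul_le_mul_of_nonneg_right
      ((lev_strictMono q ht).monotone hgf) hρ).trans ?_)
    rw [lev_succ]
    simp only [zero_add, low] at h₁
    nlinarith

/-- Chain inequalities are Tutte inequalities, and the remaining Tutte inequalities are redundant by
`le_of_inBox`. So cells of different codes differ only in their boxes. -/
theorem reg_iff_box_and_tutteCond (hq : 0 < q) (ht : 0 < t) :
    ∀ {l : List ℕ} {f : ℕ} {ρ : ℝ} {Y : ℕ → ℝ}, InBox q t f ρ (Y 0) → Climb f l →
    (Reg q t l f ρ Y ↔ Box q t l ρ Y ∧ TutteCond q t l.length ρ Y)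
  | [], _, _, _, _, _ => by simp [Reg, Box, TutteCond]
  | g :: l, f, ρ, Y, hw, hc => by
    rw [Reg, Box, List.length_cons, TutteCond, ← and_assoc]
    constructor
    · rintro ⟨⟨h₁, h₂⟩, h₃, h₄⟩
      obtain ⟨h₅, h₆⟩ := inBox_step hq ht hw.1 h₁ h₂
      obtain ⟨h₇, h₈⟩ := (reg_iff_box_and_tutteCond hq ht h₅ hc.2).1 h₄
      rw [← h₆]
      refine ⟨⟨⟨h₁, h₂⟩, h₇⟩, ⟨?_, ?_⟩, h₈⟩
      · exact nonneg_of_mul_nonneg_right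
          ((mul_nonneg (low_nonneg hq ht g) hw.1).trans h₁) hq
      · by_cases h : f ≠ 0 ∧ g = f + 1
        · exact h₃ h.1 h.2
        · exact le_of_inBox ht hw hc.1 (fun hf hg => h ⟨hf, hg⟩) h₂
    · rintro ⟨⟨⟨h₁, h₂⟩, h₇⟩, ⟨-, h₃⟩, h₈⟩
      obtain ⟨h₅, h₆⟩ := inBox_step hq ht hw.1 h₁ h₂
      rw [← h₆] at h₈
      exact ⟨⟨h₁, h₂⟩, fun _ _ => h₃, (reg_iff_box_and_tutteCond hq ht h₅ hc.2).2 ⟨h₇, h₈⟩⟩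

theorem exists_box (hq : 0 < q) (ht : 0 < t) : ∀ {n f : ℕ} {ρ : ℝ} {Y : ℕ → ℝ},
    InBox q t f ρ (Y 0) → TutteCond q t n ρ Y →
    ∃ l : List ℕ, l.length = n ∧ Climb f l ∧ Box q t l ρ Y
  | 0, _, _, _, _, _ => ⟨[], rfl, trivial, trivial⟩
  | n + 1, f, ρ, Y, hw, ⟨⟨h₁, h₂⟩, h₃⟩ => by
    -- The least level above the coordinate will be its code; this bound shows that it is at most `f
    -- + 1`.
    have hex : q * Y 1 ≤ lev q t (f + 1) * ρ := by
      rw [lev_succ]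
      have := hw.2.2.1
      nlinarith
    classical
    have hex' : ∃ k, q * Y 1 ≤ lev q t k * ρ := ⟨_, hex⟩
    have hlow : low q t (Nat.find hex') * ρ ≤ q * Y 1 := by
      cases h : Nat.find hex' with
      | zero => simpa [low] using mul_nonneg hq.le h₁
      | succ k => exact (not_le.1 (Nat.find_min hex' (m := k) (by omega))).le
    have hlev := Nat.find_spec hex'
    obtain ⟨h₅, h₆⟩ := inBox_step hq ht hw.1 hlow hlev
    rw [← h₆] at h₃
    obtain ⟨l, hl, hc, hb⟩ := exists_box hq ht h₅ h₃
    exact ⟨Nat.find hex' :: l, by rw [List.length_cons, hl], ⟨Nat.find_min' hex' hex, hc⟩,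
      ⟨hlow, hlev⟩, hb⟩

theorem slackTerm_nonneg {g g' : ℕ} {ρ a : ℝ} (hρ : 0 ≤ ρ) (h₁ : low q t g * ρ ≤ q * a)
    (h₂ : q * a ≤ lev q t g * ρ) : 0 ≤ slackTerm q t g g' ρ a := by
  rw [slackTerm]
  split_ifs with _ _ hg
  · exact le_rfl
  · linarith
  · subst hg; simp only [low] at h₁; linarith
  · exact hρ

theorem slackTerm_pos {g g' : ℕ} {ρ a : ℝ} (hρ : 0 < ρ) (h₁ : low q t g * ρ < q * a)
    (h₂ : q * a < lev q t g * ρ) (hne : g ≠ g') : 0 < slackTerm q t g g' ρ a := by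
  rw [slackTerm, if_neg hne]
  split_ifs with _ hg
  · linarith
  · subst hg; simp only [low] at h₁; linarith
  · exact hρ

/-- Intervals with adjacent codes share one wall. Intervals whose codes differ by at least two can
meet only if the scale is zero, which explains the value `ρ` in that case. -/
theorem slackTerm_eq_zero_iff (hq : 0 < q) (ht : 0 < t) {g g' : ℕ} {ρ a : ℝ} (hρ : 0 ≤ ρ)
    (h₁ : low q t g * ρ ≤ q * a) (h₂ : q * a ≤ lev q t g * ρ) :
    slackTerm q t g g' ρ a = 0 ↔ low q t g' * ρ ≤ q * a ∧ q * a ≤ lev q t g' * ρ := by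
  have hmono := lev_strictMono q ht
  rw [slackTerm]
  split_ifs with hg hg₁ hg₂
  · subst hg
    simp [h₁, h₂]
  · subst hg₁
    have := mul_le_mul_of_nonneg_right (hmono (Nat.lt_succ_self g)).le hρ
    simp only [low]
    constructor
    · intro h; exact ⟨by linarith, by linarith⟩
    · intro h; linarith [h.1]
  · subst hg₂
    have h₁' : lev q t g' * ρ ≤ q * a := h₁
    have := mul_le_mul_of_nonneg_right (low_lt_lev hq ht g').le hρ
    constructor
    · intro h; exact ⟨by linarith, by linarith⟩
    · intro h; linarith [h.2]
  · constructor
    · rintro rfl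
      simp only [mul_zero] at h₁ h₂ ⊢
      exact ⟨h₁, h₂⟩
    · rintro ⟨h₄, h₅⟩
      by_contra hne
      have hpos : 0 < ρ := lt_of_le_of_ne hρ (Ne.symm hne)
      have h₆ := le_of_mul_le_mul_right (h₄.trans h₂) hpos
      have h₇ := le_of_mul_le_mul_right (h₁.trans h₅) hpos
      rcases lt_or_gt_of_ne hg with hlt | hlt
      · obtain ⟨k, rfl⟩ := Nat.exists_eq_add_of_lt hlt
        have := hmono.le_iff_le.1 (show lev q t (g + k) ≤ lev q t g from h₆)
        omega
      · obtain ⟨k, rfl⟩ := Nat.exists_eq_add_of_lt hlt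
        have := hmono.le_iff_le.1 (show lev q t (g' + k) ≤ lev q t g' from h₇)
        omega

theorem slack_nonneg (hq : 0 < q) (ht : 0 < t) : ∀ {l l' : List ℕ} {ρ : ℝ} {Y : ℕ → ℝ}, 0 ≤ ρ →
    Box q t l ρ Y → 0 ≤ slack q t l l' ρ Y
  | [], _, _, _, _, _ => by simp [slack]
  | _ :: _, [], _, _, _, _ => by simp [slack]
  | g :: l, g' :: l', ρ, Y, hρ, ⟨⟨h₁, h₂⟩, h₃⟩ => by
    rw [slack]
    exact add_nonneg (slackTerm_nonneg hρ h₁ h₂)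
      (slack_nonneg hq ht (inBox_step hq ht hρ h₁ h₂).1.1 h₃)

theorem slack_eq_zero_iff (hq : 0 < q) (ht : 0 < t) :
    ∀ {l l' : List ℕ} {ρ : ℝ} {Y : ℕ → ℝ}, l.length = l'.length → 0 ≤ ρ → Box q t l ρ Y →
    (slack q t l l' ρ Y = 0 ↔ Box q t l' ρ Y)
  | [], [], _, _, _, _, _ => by simp [slack, Box]
  | [], _ :: _, _, _, h, _, _ => by simp at h
  | _ :: _, [], _, _, h, _, _ => by simp at h
  | g :: l, g' :: l', ρ, Y, hlen, hρ, ⟨⟨h₁, h₂⟩, h₃⟩ => by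
    have hlen' : l.length = l'.length := by simpa using hlen
    have hρ' := (inBox_step hq ht hρ h₁ h₂).1.1
    rw [slack, add_eq_zero_iff_of_nonneg (slackTerm_nonneg hρ h₁ h₂)
      (slack_nonneg hq ht hρ' h₃), slackTerm_eq_zero_iff hq ht hρ h₁ h₂,
      slack_eq_zero_iff hq ht hlen' hρ' h₃, Box]
    refine and_congr_right fun h' => ?_
    rw [(inBox_step hq ht hρ h₁ h₂).2, (inBox_step hq ht hρ h'.1 h'.2).2]

/-- Keep every coordinate strictly between its walls: the scale stays positive, and the first
difference of the codes contributes a positive term. So `slack` is not identically zero. -/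
theorem exists_slack_pos (hq : 0 < q) (ht : 0 < t) : ∀ {l l' : List ℕ} {ρ : ℝ} (w : ℝ), 0 < ρ →
    l.length = l'.length →
    ∃ Y : ℕ → ℝ, Y 0 = w ∧ Box q t l ρ Y ∧ (l ≠ l' → 0 < slack q t l l' ρ Y)
  | [], [], _, w, _, _ => ⟨fun _ => w, rfl, trivial, fun h => absurd rfl h⟩
  | [], _ :: _, _, _, _, h => by simp at h
  | _ :: _, [], _, _, _, h => by simp at h
  | g :: l, g' :: l', ρ, w, hρ, hlen => by
    have hlen' : l.length = l'.length := by simpa using hlen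
    obtain ⟨c, hc₁, hc₂⟩ := exists_between (low_lt_lev hq ht g)
    have hc : 0 < c := (low_nonneg hq ht g).trans_lt hc₁
    have ha : 0 < c * ρ / q := by positivity
    have hqa : q * (c * ρ / q) = c * ρ := by field_simp
    have hρ' : 0 < if g = 0 then c * ρ / q else ρ := by split_ifs; exacts [ha, hρ]
    obtain ⟨Y, hY₀, hY, hs⟩ := exists_slack_pos hq ht (l := l) (l' := l') (c * ρ / q) hρ' hlen'
    have h₁ : low q t g * ρ < q * (c * ρ / q) := by rw [hqa]; exact mul_lt_mul_of_pos_right hc₁ hρ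
    have h₂ : q * (c * ρ / q) < lev q t g * ρ := by rw [hqa]; exact mul_lt_mul_of_pos_right hc₂ hρ
    refine ⟨fun i => if i = 0 then w else Y (i - 1), rfl, ?_, fun hne => ?_⟩
    · simp only [Box, one_ne_zero, if_false, Nat.sub_self, hY₀, Nat.add_eq_zero_iff, and_false,
        Nat.add_sub_cancel]
      exact ⟨⟨h₁.le, h₂.le⟩, hY⟩
    · simp only [slack, one_ne_zero, if_false, Nat.sub_self, hY₀, Nat.add_eq_zero_iff, and_false,
        Nat.add_sub_cancel]
      by_cases hg : g = g'
      · have hl : l ≠ l' := fun h => hne (by rw [hg, h])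
        exact add_pos_of_nonneg_of_pos (slackTerm_nonneg hρ.le h₁.le h₂.le) (hs hl)
      · exact add_pos_of_pos_of_nonneg (slackTerm_pos hρ h₁ h₂ hg) (slack_nonneg hq ht hρ'.le hY)

theorem slack_congr : ∀ {l l' : List ℕ} {ρ : ℝ} {Y Y' : ℕ → ℝ},
    (∀ i < l.length, Y (i + 1) = Y' (i + 1)) → slack q t l l' ρ Y = slack q t l l' ρ Y'
  | [], _, _, _, _, _ => by simp [slack]
  | _ :: _, [], _, _, _, _ => by simp [slack]
  | g :: l, g' :: l', ρ, Y, Y', h => by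
    have h₁ : Y 1 = Y' 1 := h 0 (by simp)
    rw [slack, slack, h₁, slack_congr (Y := fun i => Y (i + 1)) (Y' := fun i => Y' (i + 1))
      (fun i hi => h (i + 1) (by simpa using hi))]

theorem exists_bound_box (q t : ℝ) (hq : 0 < q) (ht : 0 < t) : ∀ l : List ℕ, ∃ M : ℝ,
    ∀ (ρ : ℝ) (Y : ℕ → ℝ), 0 ≤ ρ → ρ ≤ 1 → Box q t l ρ Y → ∀ i < l.length, |Y (i + 1)| ≤ M
  | [] => ⟨0, by simp⟩
  | g :: l => by
    obtain ⟨M, hM⟩ := exists_bound_box q t hq ht l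
    refine ⟨max (lev q t g / q) M, fun ρ Y hρ hρ₁ ⟨⟨h₁, h₂⟩, h₃⟩ => ?_⟩
    have hY : 0 ≤ Y 1 :=
      nonneg_of_mul_nonneg_right ((mul_nonneg (low_nonneg hq ht g) hρ).trans h₁) hq
    have hstep := inBox_step hq ht hρ h₁ h₂
    rw [List.length_cons, Nat.forall_lt_succ_left]
    constructor
    · refine le_max_of_le_left ?_
      rw [zero_add, abs_of_nonneg hY, le_div_iff₀ hq, mul_comm]
      exact h₂.trans (mul_le_of_le_one_right (lev_pos hq ht g).le hρ₁)
    · intro i hi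
      refine le_max_of_le_right (hM _ _ hstep.1.1 ?_ h₃ i hi)
      rw [hstep.2]
      exact (min_le_left _ _).trans hρ₁

/-- As `t * (1 - q)` is nonnegative, the inequality with the running minimum is the conjunction of
the inequalities with each of the earlier coordinates. -/
theorem tutteCond_iff : ∀ {n : ℕ} {ρ : ℝ} {Y : ℕ → ℝ}, 0 ≤ t * (1 - q) →
    (TutteCond q t n ρ Y ↔ ∀ i < n, 0 ≤ Y (i + 1) ∧
      q * Y (i + 1) ≤ q * (1 + t) * Y i + t * (1 - q) * ρ ∧
      ∀ j, 1 ≤ j → j ≤ i → q * Y (i + 1) ≤ q * (1 + t) * Y i + t * (1 - q) * Y j)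
  | 0, _, _, _ => by simp [TutteCond]
  | n + 1, ρ, Y, hc => by
    rw [TutteCond, tutteCond_iff hc, Nat.forall_lt_succ_left]
    refine and_congr ?_ ?_
    · constructor
      · rintro ⟨h₁, h₂⟩
        exact ⟨h₁, h₂, fun j h₃ h₄ => absurd h₃ (by omega)⟩
      · exact fun h => ⟨h.1, h.2.1⟩
    · refine forall_congr' fun i => forall_congr' fun _ => and_congr_right fun _ => ?_
      rw [mul_min_of_nonneg _ _ hc, ← min_add_add_left, le_min_iff, and_assoc]
      refine and_congr_right fun _ => ?_
      constructor
      · rintro ⟨h₁, h₂⟩ j hj hji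
        rcases Nat.eq_or_lt_of_le hj with rfl | hj
        · exact h₁
        · obtain ⟨k, rfl⟩ := Nat.exists_eq_add_of_lt hj
          have := h₂ (k + 1) (by omega) (by omega)
          rwa [show 1 + k + 1 = k + 1 + 1 by omega]
      · exact fun h => ⟨h 1 le_rfl (by omega), fun j hj hji => h (j + 1) (by omega) (by omega)⟩

end Box

theorem mem_tuttePolytope_iff {q t : ℝ} (hq : 0 < q) (hq1 : q ≤ 1) (ht : 0 < t) {n : ℕ}
    (x : Fin n → ℝ) :
    x ∈ tuttePolytope n q t ↔ TutteCond q t n q fun i => coord x i - (1 - q) := by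
  have hc : 0 ≤ t * (1 - q) := mul_nonneg ht.le (by linarith)
  rw [tutteCond_iff hc, tuttePolytope, Set.mem_ofPred_eq]
  have hstep : ∀ a b c : ℝ, q * (a - (1 - q)) ≤ q * (1 + t) * (b - (1 - q)) +
      t * (1 - q) * (c - (1 - q)) ↔ q * a ≤ q * (1 + t) * b - t * (1 - q) * (1 - c) := by
    intro a b c
    constructor <;> intro h <;> linarith
  have h0 : q = coord x 0 - (1 - q) := by simp [coord]
  constructor
  · rintro ⟨h₁, h₂⟩
    -- Only the last coordinate is bounded below by definition. The inequality with `j = i` bounds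
    -- each shifted coordinate by a positive multiple of the preceding one, so nonnegativity
    -- propagates backwards.
    have hnn : ∀ k ≤ n, 0 ≤ coord x (n - k) - (1 - q) := by
      intro k
      induction k with
      | zero => intro _; rw [Nat.sub_zero]; linarith
      | succ k ih =>
        intro hk
        have h₃ := ih (by omega)
        have h₄ := (hstep _ _ _).2 (h₂ (n - k) (n - k) (by omega) le_rfl (by omega))
        rw [show n - k - 1 = n - (k + 1) by omega, ← add_mul] at h₄
        exact nonneg_of_mul_nonneg_right ((mul_nonneg hq.le h₃).trans h₄) (by positivity)
    intro i hi
    refine ⟨?_, ?_, ?_⟩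
    · have := hnn (n - (i + 1)) (by omega)
      rwa [show n - (n - (i + 1)) = i + 1 by omega] at this
    · have := (hstep _ _ _).2 (h₂ (i + 1) 1 le_rfl (by omega) (by omega))
      simpa [← h0] using this
    · intro j hj hji
      have := (hstep _ _ _).2 (h₂ (i + 1) (j + 1) (by omega) (by omega) (by omega))
      simpa using this
  · intro h
    constructor
    · cases n with
      | zero => simp [coord, hq.le]
      | succ n => linarith [(h n (by omega)).1]
    · intro i j hj hji hi
      obtain ⟨i, rfl⟩ := Nat.exists_eq_add_of_le' (hj.trans hji)
      rw [← hstep]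
      rcases Nat.eq_or_lt_of_le hj with rfl | hj
      · simpa [← h0] using (h i (by omega)).2.1
      · exact (h i (by omega)).2.2 (j - 1) (by omega) (by omega)

/-! ### Affine functions, polyhedra and faces -/

/-- Affine functions on `ℝⁿ`. -/
def IsAffineFun {n : ℕ} (φ : (Fin n → ℝ) → ℝ) : Prop :=
  ∃ (a : Fin n → ℝ) (b : ℝ), ∀ x, φ x = ∑ i, a i * x i + b

section Affine

variable {n : ℕ}

theorem isAffineFun_const (c : ℝ) : IsAffineFun fun _ : Fin n → ℝ => c := ⟨0, c, by simp⟩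

theorem isAffineFun_apply (i : Fin n) : IsAffineFun fun x : Fin n → ℝ => x i :=
  ⟨Pi.single i 1, 0, by simp [Pi.single_apply]⟩

theorem IsAffineFun.add {φ ψ : (Fin n → ℝ) → ℝ} (hφ : IsAffineFun φ) (hψ : IsAffineFun ψ) :
    IsAffineFun fun x => φ x + ψ x := by
  obtain ⟨a, b, h⟩ := hφ
  obtain ⟨a', b', h'⟩ := hψ
  refine ⟨a + a', b + b', fun x => ?_⟩
  simp only [h, h', Pi.add_apply, add_mul, Finset.sum_add_distrib]
  ring

theorem IsAffineFun.const_mul {φ : (Fin n → ℝ) → ℝ} (hφ : IsAffineFun φ) (c : ℝ) :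
    IsAffineFun fun x => c * φ x := by
  obtain ⟨a, b, h⟩ := hφ
  exact ⟨c • a, c * b, fun x => by
    simp only [h, mul_add, Finset.mul_sum, Pi.smul_apply, smul_eq_mul, mul_assoc]⟩

theorem IsAffineFun.sub {φ ψ : (Fin n → ℝ) → ℝ} (hφ : IsAffineFun φ) (hψ : IsAffineFun ψ) :
    IsAffineFun fun x => φ x - ψ x := by
  simpa [sub_eq_add_neg] using hφ.add (hψ.const_mul (-1))

theorem isAffineFun_coord (p : ℕ) : IsAffineFun fun x : Fin n → ℝ => coord x p := by
  cases p with
  | zero => exact isAffineFun_const 1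
  | succ p =>
    by_cases h : p < n
    · simpa [coord, h] using isAffineFun_apply (⟨p, h⟩ : Fin n)
    · simpa [coord, h] using isAffineFun_const (n := n) 0

theorem IsAffineFun.map_lineMap {φ : (Fin n → ℝ) → ℝ} (hφ : IsAffineFun φ) (x y : Fin n → ℝ)
    (s : ℝ) : φ (x + s • (y - x)) = φ x + s * (φ y - φ x) := by
  obtain ⟨a, b, h⟩ := hφ
  have : ∑ i, a i * (x + s • (y - x)) i =
      ∑ i, a i * x i + s * (∑ i, a i * y i - ∑ i, a i * x i) := by
    rw [← Finset.sum_sub_distrib, Finset.mul_sum, ← Finset.sum_add_distrib]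
    refine Finset.sum_congr rfl fun i _ => ?_
    simp only [Pi.add_apply, Pi.smul_apply, Pi.sub_apply, smul_eq_mul]
    ring
  rw [h, h, h, this]
  ring

/-- On the line from a point of `U` to `y` the function is affine in one variable and vanishes at
two points. -/
theorem IsAffineFun.eq_zero_of_isOpen {φ : (Fin n → ℝ) → ℝ} (hφ : IsAffineFun φ)
    {U : Set (Fin n → ℝ)} (hU : IsOpen U) (hne : U.Nonempty) (h : ∀ x ∈ U, φ x = 0)
    (y : Fin n → ℝ) : φ y = 0 := by
  obtain ⟨x, hx⟩ := hne
  have hcont : Continuous fun s : ℝ => x + s • (y - x) := by fun_prop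
  have hnhds : (fun s : ℝ => x + s • (y - x)) ⁻¹' U ∈ nhds (0 : ℝ) :=
    hcont.continuousAt.preimage_mem_nhds (by simpa using hU.mem_nhds hx)
  obtain ⟨ε, hε, hball⟩ := Metric.mem_nhds_iff.1 hnhds
  have hs : ε / 2 ∈ Metric.ball (0 : ℝ) ε := by
    rw [Metric.mem_ball, Real.dist_eq, sub_zero, abs_of_pos (by positivity)]
    linarith
  have := h _ (hball hs)
  rw [hφ.map_lineMap, h x hx] at this
  have hε' : ε / 2 ≠ 0 := by positivity
  simpa [hε'] using this

theorem isExposed_of_affine {A : Set (Fin n → ℝ)} {φ : (Fin n → ℝ) → ℝ} (hφ : IsAffineFun φ)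
    (hA : ∀ x ∈ A, 0 ≤ φ x) : IsExposed ℝ A {x ∈ A | φ x = 0} := by
  rintro ⟨z, hz, hz'⟩
  obtain ⟨a, b, h⟩ := hφ
  -- A face is exposed by maximizing a functional, hence the negative of the linear part. A point
  -- with `φ = 0` exists, so the minimum of `φ` is zero.
  refine ⟨∑ i, (-a i) • ContinuousLinearMap.proj (R := ℝ) (φ := fun _ : Fin n => ℝ) i, ?_⟩
  have hl : ∀ x : Fin n → ℝ, (∑ i, (-a i) • ContinuousLinearMap.proj (R := ℝ)
      (φ := fun _ : Fin n => ℝ) i) x = b - φ x := by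
    intro x
    rw [h, sum_apply]
    simp
  ext x
  simp only [Set.mem_ofPred_eq, hl]
  refine and_congr_right fun hx => ?_
  constructor
  · intro hx' y hy
    have := hA y hy
    linarith
  · intro hx'
    have h₁ := hx' z hz
    have h₂ := hA x hx
    linarith

theorem IsPolyhedron.inter {P Q : Set (Fin n → ℝ)} (hP : IsPolyhedron P) (hQ : IsPolyhedron Q) :
    IsPolyhedron (P ∩ Q) := by
  classical
  obtain ⟨H, rfl⟩ := hP
  obtain ⟨H', rfl⟩ := hQ
  refine ⟨H ∪ H', ?_⟩
  ext x
  simp only [Set.mem_inter_iff, Set.mem_ofPred_eq, Finset.mem_union]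
  exact ⟨fun h z hz => hz.elim (h.1 z) (h.2 z),
    fun h => ⟨fun z hz => h z (Or.inl hz), fun z hz => h z (Or.inr hz)⟩⟩

theorem isPolyhedron_univ : IsPolyhedron (Set.univ : Set (Fin n → ℝ)) := ⟨∅, by simp⟩

theorem isPolyhedron_le {φ ψ : (Fin n → ℝ) → ℝ} (hφ : IsAffineFun φ) (hψ : IsAffineFun ψ) :
    IsPolyhedron {x | φ x ≤ ψ x} := by
  obtain ⟨a, b, h⟩ := hφ.sub hψ
  refine ⟨{(a, -b)}, ?_⟩
  ext x
  have := h x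
  simp only [Set.mem_ofPred_eq, Finset.mem_singleton, forall_eq]
  constructor <;> intro _ <;> linarith

theorem IsPolyhedron.convex {P : Set (Fin n → ℝ)} (hP : IsPolyhedron P) : Convex ℝ P := by
  obtain ⟨H, rfl⟩ := hP
  intro x hx y hy a b ha hb hab h hh
  have h₁ := mul_le_mul_of_nonneg_left (hx h hh) ha
  have h₂ := mul_le_mul_of_nonneg_left (hy h hh) hb
  have h₃ : ∑ i, h.1 i * (a • x + b • y) i = a * ∑ i, h.1 i * x i + b * ∑ i, h.1 i * y i := by
    rw [Finset.mul_sum, Finset.mul_sum, ← Finset.sum_add_distrib]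
    refine Finset.sum_congr rfl fun i _ => ?_
    simp only [Pi.add_apply, Pi.smul_apply, smul_eq_mul]
    ring
  rw [h₃]
  calc _ ≤ a * h.2 + b * h.2 := add_le_add h₁ h₂
    _ = h.2 := by rw [← add_mul, hab, one_mul]

theorem IsPolyhedron.isClosed {P : Set (Fin n → ℝ)} (hP : IsPolyhedron P) : IsClosed P := by
  obtain ⟨H, rfl⟩ := hP
  simp only [Set.ofPred_forall]
  exact isClosed_biInter fun h _ => isClosed_le (by fun_prop) continuous_const

variable {q t : ℝ}

theorem isPolyhedron_reg : ∀ (l : List ℕ) (f : ℕ) {ρ : (Fin n → ℝ) → ℝ}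
    {Y : ℕ → (Fin n → ℝ) → ℝ}, IsAffineFun ρ → (∀ i, IsAffineFun (Y i)) →
    IsPolyhedron {x | Reg q t l f (ρ x) fun i => Y i x}
  | [], _, _, _, _, _ => by simpa [Reg] using isPolyhedron_univ
  | g :: l, f, ρ, Y, hρ, hY => by
    have h₁ := isPolyhedron_le (hρ.const_mul (low q t g)) ((hY 1).const_mul q)
    have h₂ := isPolyhedron_le ((hY 1).const_mul q) (hρ.const_mul (lev q t g))
    have h₃ := isPolyhedron_le ((hY 1).const_mul q)
      (((hY 0).const_mul (q * (1 + t))).add (hρ.const_mul (t * (1 - q))))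
    have h₄ := isPolyhedron_reg l g (ρ := fun x => if g = 0 then Y 1 x else ρ x)
      (Y := fun i => Y (i + 1)) (by split_ifs; exacts [hY 1, hρ]) fun i => hY (i + 1)
    have h₅ : IsPolyhedron {x | f ≠ 0 → g = f + 1 →
        q * Y 1 x ≤ q * (1 + t) * Y 0 x + t * (1 - q) * ρ x} := by
      by_cases h : f ≠ 0 ∧ g = f + 1
      · simpa [h.1, h.2] using h₃
      · convert isPolyhedron_univ (n := n)
        ext x
        simp only [Set.mem_ofPred_eq, Set.mem_univ, iff_true]
        exact fun hf hg => absurd ⟨hf, hg⟩ h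
    exact h₁.inter (h₂.inter (h₅.inter h₄))

theorem isAffineFun_slack : ∀ (l l' : List ℕ) {ρ : (Fin n → ℝ) → ℝ}
    {Y : ℕ → (Fin n → ℝ) → ℝ}, IsAffineFun ρ → (∀ i, IsAffineFun (Y i)) →
    IsAffineFun fun x => slack q t l l' (ρ x) fun i => Y i x
  | [], _, _, _, _, _ => by simpa [slack] using isAffineFun_const 0
  | _ :: _, [], _, _, _, _ => by simpa [slack] using isAffineFun_const 0
  | g :: l, g' :: l', ρ, Y, hρ, hY => by
    have h₄ := isAffineFun_slack l l' (ρ := fun x => if g = 0 then Y 1 x else ρ x)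
      (Y := fun i => Y (i + 1)) (by split_ifs; exacts [hY 1, hρ]) fun i => hY (i + 1)
    refine IsAffineFun.add ?_ h₄
    simp only [slackTerm]
    split_ifs
    · exact isAffineFun_const 0
    · exact (hρ.const_mul _).sub ((hY 1).const_mul q)
    · exact ((hY 1).const_mul q).sub (hρ.const_mul _)
    · exact hρ

end Affine

/-! ### The subdivision of the Tutte polytope -/

section Subdivision

variable {q t : ℝ} {n : ℕ}

theorem inBox_initial (hq : 0 < q) (x : Fin n → ℝ) : InBox q t 0 q (coord x 0 - (1 - q)) := by
  simp [InBox, low, lev_zero, coord, hq.le, mul_nonneg hq.le hq.le]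

theorem isAffineFun_coord_sub (i : ℕ) :
    IsAffineFun fun x : Fin n → ℝ => coord x i - (1 - q) :=
  (isAffineFun_coord i).sub (isAffineFun_const _)

theorem length_tail_codeTop (F : PlaneForestOn (n + 1)) : F.1.codeTop.tail.length = n := by
  rw [List.length_tail, PlaneForest.length_codeTop, F.2, Nat.add_sub_cancel]

theorem codeTop_eq_cons (F : PlaneForestOn (n + 1)) : F.1.codeTop = 0 :: F.1.codeTop.tail := by
  obtain ⟨F, hF⟩ := F
  cases F with
  | nil => simp [PlaneForest.numNodes] at hF
  | cons c r => rfl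

theorem climb_tail_codeTop (F : PlaneForestOn (n + 1)) : Climb 0 F.1.codeTop.tail := by
  have := F.1.climb_codeTop
  rw [codeTop_eq_cons] at this
  exact this.2

theorem mem_forestPolytope_iff_box (hq : 0 < q) (hq1 : q ≤ 1) (ht : 0 < t)
    (F : PlaneForestOn (n + 1)) (x : Fin n → ℝ) :
    x ∈ forestPolytope q t F ↔ (Box q t F.1.codeTop.tail q fun i => coord x i - (1 - q)) ∧
      x ∈ tuttePolytope n q t := by
  rw [mem_forestPolytope_iff hq ht, reg_iff_box_and_tutteCond hq ht (inBox_initial hq x)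
    (climb_tail_codeTop F), mem_tuttePolytope_iff hq hq1 ht, length_tail_codeTop]

theorem isBoundedPolytope_forestPolytope (hq : 0 < q) (hq1 : q ≤ 1) (ht : 0 < t)
    (F : PlaneForestOn (n + 1)) : IsBoundedPolytope (forestPolytope q t F) := by
  constructor
  · rw [Set.ext (mem_forestPolytope_iff hq ht F)]
    exact isPolyhedron_reg _ _ (isAffineFun_const q) isAffineFun_coord_sub
  · obtain ⟨M, hM⟩ := exists_bound_box q t hq ht F.1.codeTop.tail
    refine (Metric.isBounded_closedBall (x := fun _ => 1 - q) (r := max M 0)).subset fun x hx => ?_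
    rw [Metric.mem_closedBall, dist_pi_le_iff (le_max_right _ _)]
    intro i
    have := hM q _ hq.le hq1 ((mem_forestPolytope_iff_box hq hq1 ht F x).1 hx).1 i
      (by rw [length_tail_codeTop]; exact i.2)
    rw [coord_succ x i.2] at this
    exact le_max_of_le_left this

theorem iUnion_forestPolytope (hq : 0 < q) (hq1 : q ≤ 1) (ht : 0 < t) :
    ⋃ F : PlaneForestOn (n + 1), forestPolytope q t F = tuttePolytope n q t := by
  ext x
  simp only [Set.mem_iUnion, mem_forestPolytope_iff_box hq hq1 ht]
  constructor
  · rintro ⟨F, h⟩; exact h.2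
  · intro hx
    obtain ⟨l, hl, hc, hb⟩ :=
      exists_box hq ht (inBox_initial hq x) ((mem_tuttePolytope_iff hq hq1 ht x).1 hx)
    obtain ⟨F, hF⟩ := PlaneForest.exists_codeTop_eq _ (l := 0 :: l) (b := 0) le_rfl (by simp)
      ⟨Nat.zero_le _, hc⟩
    refine ⟨⟨F, ?_⟩, ?_, hx⟩
    · rw [← PlaneForest.length_codeTop, hF, List.length_cons, hl]
    · simpa [hF] using hb

theorem inter_forestPolytope (hq : 0 < q) (hq1 : q ≤ 1) (ht : 0 < t)
    (F F' : PlaneForestOn (n + 1)) : forestPolytope q t F ∩ forestPolytope q t F' =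
      {x ∈ forestPolytope q t F |
        slack q t F.1.codeTop.tail F'.1.codeTop.tail q (fun i => coord x i - (1 - q)) = 0} := by
  ext x
  refine and_congr_right fun hx => ?_
  have hx' := (mem_forestPolytope_iff_box hq hq1 ht F x).1 hx
  rw [mem_forestPolytope_iff_box hq hq1 ht, slack_eq_zero_iff hq ht
    (by rw [length_tail_codeTop, length_tail_codeTop]) hq.le hx'.1, and_iff_left hx'.2]

theorem isExposed_inter_forestPolytope (hq : 0 < q) (hq1 : q ≤ 1) (ht : 0 < t)
    (F F' : PlaneForestOn (n + 1)) :
    IsExposed ℝ (forestPolytope q t F) (forestPolytope q t F ∩ forestPolytope q t F') := by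
  rw [inter_forestPolytope hq hq1 ht]
  exact isExposed_of_affine (isAffineFun_slack _ _ (isAffineFun_const q) isAffineFun_coord_sub)
    fun x hx => slack_nonneg hq ht hq.le ((mem_forestPolytope_iff_box hq hq1 ht F x).1 hx).1

/-- If the interiors met, the affine function `slack` would vanish on a nonempty open set, hence
everywhere, against `exists_slack_pos`. -/
theorem disjoint_interior_forestPolytope (hq : 0 < q) (hq1 : q ≤ 1) (ht : 0 < t)
    {F F' : PlaneForestOn (n + 1)} (hne : F ≠ F') :
    Disjoint (interior (forestPolytope q t F)) (interior (forestPolytope q t F')) := by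
  rw [Set.disjoint_iff_inter_eq_empty]
  by_contra hemp
  have hzero := (isAffineFun_slack (q := q) (t := t) F.1.codeTop.tail F'.1.codeTop.tail
    (isAffineFun_const q) (isAffineFun_coord_sub (n := n) (q := q))).eq_zero_of_isOpen
    (isOpen_interior.inter isOpen_interior) (Set.nonempty_iff_ne_empty.2 hemp) (fun x hx => by
      have : x ∈ forestPolytope q t F ∩ forestPolytope q t F' :=
        ⟨interior_subset hx.1, interior_subset hx.2⟩
      rw [inter_forestPolytope hq hq1 ht] at this
      exact this.2)
  obtain ⟨Y, -, -, hpos⟩ := exists_slack_pos hq ht (l := F.1.codeTop.tail)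
    (l' := F'.1.codeTop.tail) 0 hq (by rw [length_tail_codeTop, length_tail_codeTop])
  have hne' : F.1.codeTop.tail ≠ F'.1.codeTop.tail := fun h => hne (Subtype.ext
    (PlaneForest.codeTop_injective (by rw [codeTop_eq_cons F, codeTop_eq_cons F', h])))
  have h := hzero fun i => Y (i + 1) + (1 - q)
  rw [slack_congr (Y' := Y)] at h
  · exact (hpos hne').ne' h
  · intro i hi
    rw [length_tail_codeTop] at hi
    rw [coord_succ _ hi]
    ring

end Subdivision

/-! ### Volumes -/

section Volumes

open MeasureTheory

/-- The number of entries at the beginning of `l` that continue the chain to which the preceding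
code `f` belongs. -/
def chainLength : List ℕ → ℕ → ℕ
  | [], _ => 0
  | g :: l, f => if f ≠ 0 ∧ g = f + 1 then chainLength l g + 1 else 0

/-- The volume of the region of the codes `l` for the scale one, if no chain is continued. -/
noncomputable def codeWeight (q t : ℝ) : List ℕ → ℝ
  | [] => 1
  | g :: l => (if g = 0 then 1 / (l.length + 1 : ℝ)
      else (1 + t) ^ (g - 1) * t / (q * (chainLength l g + 1))) * codeWeight q t l

/-- The sequence `w, y₁, …, y_n, 0, 0, …`. -/
def seqOf {n : ℕ} (w : ℝ) (y : Fin n → ℝ) : ℕ → ℝ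
  | 0 => w
  | i + 1 => if h : i < n then y ⟨i, h⟩ else 0

theorem chainLength_le_length : ∀ (l : List ℕ) (f : ℕ), chainLength l f ≤ l.length
  | [], _ => le_rfl
  | g :: l, f => by
    have := chainLength_le_length l g
    rw [chainLength, List.length_cons]
    split_ifs <;> omega

theorem chainLength_zero (l : List ℕ) : chainLength l 0 = 0 := by cases l <;> simp [chainLength]

theorem codeWeight_pos {q t : ℝ} (hq : 0 < q) (ht : 0 < t) : ∀ l, 0 < codeWeight q t l
  | [] => one_pos
  | g :: l => by
    have := codeWeight_pos hq ht l
    rw [codeWeight]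
    split_ifs <;> positivity

theorem seqOf_cons {n : ℕ} (w a : ℝ) (z : Fin n → ℝ) :
    (fun i => seqOf w (Fin.cons a z : Fin (n + 1) → ℝ) (i + 1)) = seqOf a z := by
  funext i
  cases i with
  | zero => simp [seqOf]
  | succ i =>
    simp only [seqOf, Nat.add_lt_add_iff_right]
    split_ifs with h
    · exact Fin.cons_succ (α := fun _ => ℝ) a z ⟨i, h⟩
    · rfl

theorem isAffineFun_seqOf {n : ℕ} (w : ℝ) (i : ℕ) :
    IsAffineFun fun y : Fin n → ℝ => seqOf w y i := by
  cases i with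
  | zero => exact isAffineFun_const w
  | succ i =>
    by_cases h : i < n
    · simpa [seqOf, h] using isAffineFun_apply (⟨i, h⟩ : Fin n)
    · simpa [seqOf, h] using isAffineFun_const (n := n) 0

theorem volume_eq_lintegral_cons {n : ℕ} {S : Set (Fin (n + 1) → ℝ)} (hS : MeasurableSet S) :
    volume S = ∫⁻ a : ℝ, volume {z : Fin n → ℝ | (Fin.cons a z : Fin (n + 1) → ℝ) ∈ S} := by
  have hmp := (volume_preserving_piFinSuccAbove (fun _ : Fin (n + 1) => ℝ) 0).symm
  rw [← hmp.measure_preimage hS.nullMeasurableSet, Measure.volume_eq_prod,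
    Measure.prod_apply (hmp.measurable hS)]
  refine lintegral_congr fun a => ?_
  congr 1
  ext z
  simp [MeasurableEquiv.piFinSuccAbove, Fin.insertNthEquiv]

theorem lintegral_Icc_pow {A B K : ℝ} (hAB : A ≤ B) (hK : 0 ≤ K) (m : ℕ) :
    ∫⁻ a in Set.Icc A B, ENNReal.ofReal (K * (a - A) ^ m) =
      ENNReal.ofReal (K * ((B - A) ^ (m + 1) / (m + 1))) := by
  have hcont : Continuous fun a : ℝ => K * (a - A) ^ m := by fun_prop
  rw [← ofReal_integral_eq_lintegral_ofReal]
  · rw [integral_Icc_eq_integral_Ioc, ← intervalIntegral.integral_of_le hAB,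
      intervalIntegral.integral_const_mul,
      intervalIntegral.integral_comp_sub_right (fun a => a ^ m), integral_pow, sub_self]
    simp
  · exact hcont.continuousOn.integrableOn_compact isCompact_Icc
  · refine (ae_restrict_iff' measurableSet_Icc).2 (Filter.Eventually.of_forall fun a ha => ?_)
    exact mul_nonneg hK (pow_nonneg (sub_nonneg.2 ha.1) m)

section Volume

variable {q t : ℝ}

theorem volume_reg_cons {n g f : ℕ} {l : List ℕ} {ρ w A B K : ℝ} {m : ℕ} (hAB : A ≤ B)
    (hK : 0 ≤ K)
    (hcond : ∀ a, (low q t g * ρ ≤ q * a ∧ q * a ≤ lev q t g * ρ ∧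
      (f ≠ 0 → g = f + 1 → q * a ≤ q * (1 + t) * w + t * (1 - q) * ρ)) ↔ a ∈ Set.Icc A B)
    (hvol : ∀ a ∈ Set.Icc A B, volume {z : Fin n → ℝ |
      Reg q t l g (if g = 0 then a else ρ) (seqOf a z)} = ENNReal.ofReal (K * (a - A) ^ m)) :
    volume {y : Fin (n + 1) → ℝ | Reg q t (g :: l) f ρ (seqOf w y)} =
      ENNReal.ofReal (K * ((B - A) ^ (m + 1) / (m + 1))) := by
  have hmeas : MeasurableSet {y : Fin (n + 1) → ℝ | Reg q t (g :: l) f ρ (seqOf w y)} :=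
    (isPolyhedron_reg (g :: l) f (isAffineFun_const ρ)
      (isAffineFun_seqOf w)).isClosed.measurableSet
  rw [volume_eq_lintegral_cons hmeas, ← lintegral_Icc_pow hAB hK, ← lintegral_indicator
    measurableSet_Icc]
  refine lintegral_congr fun a => ?_
  have hset : {z : Fin n → ℝ | (Fin.cons a z : Fin (n + 1) → ℝ) ∈
      {y : Fin (n + 1) → ℝ | Reg q t (g :: l) f ρ (seqOf w y)}} =
      {z | a ∈ Set.Icc A B ∧ Reg q t l g (if g = 0 then a else ρ) (seqOf a z)} := by
    ext z
    have h1 : seqOf w (Fin.cons a z : Fin (n + 1) → ℝ) 1 = a := congrFun (seqOf_cons w a z) 0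
    have h0 : seqOf w (Fin.cons a z : Fin (n + 1) → ℝ) 0 = w := rfl
    simp only [Set.mem_ofPred_eq, Reg, seqOf_cons, h1, h0, ← hcond, and_assoc]
  rw [hset]
  by_cases ha : a ∈ Set.Icc A B
  · rw [Set.indicator_of_mem ha, ← hvol a ha]
    simp only [ha, true_and]
  · rw [Set.indicator_of_notMem ha]
    simp only [ha, false_and]
    simp

/-- The last factor is the position of `w` in its interval, normalized to run from 0 to `ρ`. A chain
inequality says that this position does not increase, so `m` further siblings contribute a multiple
of its `m`-th power; all other coordinates scale with `ρ`. -/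
theorem volume_reg (hq : 0 < q) (ht : 0 < t) : ∀ {l : List ℕ} {n f : ℕ} {ρ w : ℝ}, l.length = n →
    0 ≤ ρ → (f ≠ 0 → low q t f * ρ ≤ q * w ∧ q * w ≤ lev q t f * ρ) →
    volume {y : Fin n → ℝ | Reg q t l f ρ (seqOf w y)} = ENNReal.ofReal (codeWeight q t l *
      ρ ^ (l.length - chainLength l f) * ((q * w - low q t f * ρ) / ((1 + t) ^ (f - 1) * t)) ^ chainLength l f)
  | [], n, f, ρ, w, hn, _, _ => by
    subst hn
    simp [Reg, codeWeight, chainLength, volume_pi]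
  | 0 :: l, n, f, ρ, w, hn, hρ, hw => by
    subst hn
    have hK := (codeWeight_pos hq ht l).le
    rw [List.length_cons, volume_reg_cons (A := 0) (B := ρ) (K := codeWeight q t l)
      (m := l.length) hρ hK]
    · simp [codeWeight, chainLength]
      congr 1
      ring
    · intro a
      simp [low, lev_zero, hq]
    · intro a ha
      rw [if_pos rfl, volume_reg hq ht rfl ha.1 (by simp), chainLength_zero]
      simp
  | (g + 1) :: l, n, f, ρ, w, hn, hρ, hw => by
    subst hn
    have hK := (codeWeight_pos hq ht l).le
    have hb : 0 < (1 + t) ^ g := by positivity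
    have hm := chainLength_le_length l (g + 1)
    set m := chainLength l (g + 1) with hmdef
    set A := lev q t g * ρ / q with hA
    have hqA : q * A = lev q t g * ρ := by rw [hA]; field_simp
    -- The number `v` is the largest normalized position allowed for the new coordinate: that of `w`
    -- if the chain continues, and `ρ` otherwise.
    have main : ∀ B v : ℝ, A ≤ B → B - A = (1 + t) ^ g * t / q * v →
        (∀ a, (low q t (g + 1) * ρ ≤ q * a ∧ q * a ≤ lev q t (g + 1) * ρ ∧
          (f ≠ 0 → g + 1 = f + 1 → q * a ≤ q * (1 + t) * w + t * (1 - q) * ρ)) ↔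
            a ∈ Set.Icc A B) →
        volume {y : Fin (l.length + 1) → ℝ | Reg q t ((g + 1) :: l) f ρ (seqOf w y)} =
          ENNReal.ofReal (codeWeight q t ((g + 1) :: l) * ρ ^ (l.length - m) * v ^ (m + 1)) := by
      intro B v hAB hBA hcond
      rw [volume_reg_cons (A := A) (B := B) (m := m)
        (K := codeWeight q t l * ρ ^ (l.length - m) * (q / ((1 + t) ^ g * t)) ^ m) hAB
        (by positivity) hcond]
      · rw [hBA, codeWeight, if_neg (Nat.succ_ne_zero g), Nat.add_sub_cancel, ← hmdef]
        congr 1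
        have : (q / ((1 + t) ^ g * t)) ^ m * ((1 + t) ^ g * t / q) ^ m = 1 := by
          rw [← mul_pow, div_mul_div_comm, mul_comm q, div_self (by positivity), one_pow]
        rw [mul_pow, pow_succ ((1 + t) ^ g * t / q)]
        calc _ = codeWeight q t l * ρ ^ (l.length - m) *
              ((q / ((1 + t) ^ g * t)) ^ m * ((1 + t) ^ g * t / q) ^ m) *
              ((1 + t) ^ g * t / q * v ^ (m + 1) / (m + 1)) := by ring
          _ = _ := by rw [this]; field_simp
      · intro a ha
        have hlev : q * a ≤ lev q t (g + 1) * ρ := ((hcond a).2 ha).2.1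
        have hlow : low q t (g + 1) * ρ ≤ q * a := ((hcond a).2 ha).1
        rw [if_neg (Nat.succ_ne_zero g), volume_reg hq ht rfl hρ fun _ => ⟨hlow, hlev⟩, ← hmdef,
          Nat.add_sub_cancel, low, ← hqA, mul_assoc _ (_ ^ m), ← mul_pow]
        congr 4
        ring
    rw [List.length_cons]
    by_cases h : f ≠ 0 ∧ g + 1 = f + 1
    · obtain ⟨k, rfl⟩ := Nat.exists_eq_succ_of_ne_zero h.1
      obtain rfl : g = k + 1 := by omega
      have hw' := hw h.1
      have hls := lev_succ q t k
      have hls' := lev_succ q t (k + 1)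
      simp only [Nat.succ_eq_add_one, low] at hw'
      rw [main ((q * (1 + t) * w + t * (1 - q) * ρ) / q)
        ((q * w - lev q t k * ρ) / ((1 + t) ^ k * t)), chainLength, if_pos h, ← hmdef, low,
        Nat.succ_eq_add_one, Nat.add_sub_cancel, Nat.add_sub_add_right]
      · rw [hA, div_le_div_iff_of_pos_right hq, hls]
        nlinarith [hw'.1]
      · rw [hA, hls, pow_succ]
        field_simp
        ring
      · intro a
        rw [Set.mem_Icc, hA, div_le_iff₀ hq, le_div_iff₀ hq, low, mul_comm a q]
        refine and_congr_right fun _ => ?_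
        constructor
        · exact fun h' => h'.2 h.1 h.2
        · refine fun h' => ⟨h'.trans ?_, fun _ _ => h'⟩
          rw [hls']
          nlinarith [hw'.2]
    · rw [main (lev q t (g + 1) * ρ / q) ρ, chainLength, if_neg h, Nat.sub_zero, pow_zero, mul_one,
        mul_assoc, ← pow_add]
      · congr 3
        omega
      · rw [hA, div_le_div_iff_of_pos_right hq]
        exact mul_le_mul_of_nonneg_right ((lev_strictMono q ht) (Nat.lt_succ_self g)).le hρ
      · rw [hA, lev, lev, pow_succ]
        field_simp
        ring
      · intro a
        rw [Set.mem_Icc, hA, div_le_iff₀ hq, le_div_iff₀ hq, low, mul_comm a q]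
        refine and_congr_right fun _ => and_iff_left fun h₁ h₂ => absurd ⟨h₁, h₂⟩ h

theorem volume_forestPolytope (hq : 0 < q) (ht : 0 < t) {n : ℕ} (F : PlaneForestOn (n + 1)) :
    volume (forestPolytope q t F) =
      ENNReal.ofReal (codeWeight q t F.1.codeTop.tail * q ^ n) := by
  have hpre : forestPolytope q t F = (fun x => x + fun _ => -(1 - q)) ⁻¹'
      {y : Fin n → ℝ | Reg q t F.1.codeTop.tail 0 q (seqOf q y)} := by
    ext x
    rw [mem_forestPolytope_iff hq ht]
    refine Reg.congr (by simp) fun i hi => ?_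
    rw [length_tail_codeTop] at hi
    simp [coord_succ x hi, seqOf, hi]
    ring
  rw [hpre, measure_preimage_add_right, volume_reg hq ht (length_tail_codeTop F) hq.le (by simp),
    chainLength_zero, length_tail_codeTop]
  simp

theorem volume_real_forestPolytope (hq : 0 < q) (ht : 0 < t) {n : ℕ} (F : PlaneForestOn (n + 1)) :
    volume.real (forestPolytope q t F) = codeWeight q t F.1.codeTop.tail * q ^ n := by
  rw [Measure.real, volume_forestPolytope hq ht, ENNReal.toReal_ofReal]
  have := codeWeight_pos hq ht F.1.codeTop.tail
  positivity

theorem isPolytopalSubdivision_forestPolytope (hq : 0 < q) (hq1 : q ≤ 1) (ht : 0 < t) (n : ℕ) :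
    IsPolytopalSubdivision (tuttePolytope n q t)
      (fun F : PlaneForestOn (n + 1) => forestPolytope q t F) where
  finite := ((PlaneForest.finite_numNodes_le (n + 1)).subset fun _ h => le_of_eq h).to_subtype
  isBoundedPolytope := isBoundedPolytope_forestPolytope hq hq1 ht
  interior_nonempty F := by
    by_contra h
    -- With empty interior the set would lie in its own frontier, which is null by convexity, but
    -- its volume is positive.
    have hfr := (isBoundedPolytope_forestPolytope hq hq1 ht F).1.convex.addHaar_frontier
      (μ := volume)
    have hsub : forestPolytope q t F ⊆ frontier (forestPolytope q t F) := by
      rw [frontier, Set.not_nonempty_iff_eq_empty.1 h, Set.sdiff_empty]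
      exact subset_closure
    have h0 := measure_mono_null hsub hfr
    rw [volume_forestPolytope hq ht, ENNReal.ofReal_eq_zero] at h0
    have := codeWeight_pos hq ht F.1.codeTop.tail
    exact absurd h0 (not_le.2 (by positivity))
  iUnion_eq := iUnion_forestPolytope hq hq1 ht
  disjoint_interior _ _ h := disjoint_interior_forestPolytope hq hq1 ht h
  isExposed_inter F F' := ⟨isExposed_inter_forestPolytope hq hq1 ht F F', by
    rw [Set.inter_comm]; exact isExposed_inter_forestPolytope hq hq1 ht F' F⟩

end Volume

/-- Cells with disjoint interiors overlap only in frontiers, and frontiers of convex sets are null.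
-/
theorem IsPolytopalSubdivision.volume_real_eq {n : ℕ} {ι : Type*} [Fintype ι]
    {P : Set (Fin n → ℝ)} {D : ι → Set (Fin n → ℝ)} (h : IsPolytopalSubdivision P D) :
    volume.real P = ∑ i, volume.real (D i) := by
  have hconv : ∀ i, Convex ℝ (D i) := fun i => (h.isBoundedPolytope i).1.convex
  have hclosed : ∀ i, IsClosed (D i) := fun i => (h.isBoundedPolytope i).1.isClosed
  have hdisj : Pairwise (Function.onFun (AEDisjoint volume) D) := by
    intro i j hij
    refine measure_mono_null (t := frontier (D i) ∪ frontier (D j)) ?_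
      (measure_union_null ((hconv i).addHaar_frontier _) ((hconv j).addHaar_frontier _))
    rintro x ⟨hi, hj⟩
    by_contra hx
    simp only [Set.mem_union, not_or, (hclosed i).frontier_eq, (hclosed j).frontier_eq,
      Set.mem_sdiff, not_and, not_not] at hx
    exact Set.disjoint_left.1 (h.disjoint_interior i j hij) (hx.1 hi) (hx.2 hj)
  rw [← h.iUnion_eq, measureReal_def, measure_iUnion₀ hdisj
    fun i => (hclosed i).measurableSet.nullMeasurableSet, tsum_fintype, ENNReal.toReal_sum]
  · rfl
  · exact fun i _ => (h.isBoundedPolytope i).2.measure_lt_top.ne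

end Volumes

/-! ### Closed forms -/

namespace PlaneForest

/-- The sum of the exponents of all nodes, if the roots have, from right to left, the exponents
`j, j + 1, …`. -/
def exponentSum : PlaneForest → ℕ → ℕ
  | nil, _ => 0
  | cons c r, j => j + r.numTrees + c.exponentSum (j + r.numTrees) + r.exponentSum j

/-- The sum of the exponents of all nodes, where each component is treated separately. -/
def componentExponentSum : PlaneForest → ℕ
  | nil => 0
  | cons c r => c.exponentSum 0 + r.componentExponentSum

/-- The product of the factorials of all degrees. -/
def degFactorial (F : PlaneForest) : ℕ := (F.degSeq.map Nat.factorial).prod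

/-- The product of the numbers of nodes of all forests that consist of the last components. -/
def suffixProduct : PlaneForest → ℕ
  | nil => 1
  | cons c r => (cons c r).numNodes * r.suffixProduct

/-! ### Product formula for the graph weights -/

theorem degFactorial_cons (c r : PlaneForest) :
    (cons c r).degFactorial = c.numTrees.factorial * (c.degFactorial * r.degFactorial) := by
  simp [degFactorial, degSeq]

theorem degFactorial_pos : ∀ F : PlaneForest, 0 < F.degFactorial
  | nil => one_pos
  | cons c r => by
    rw [degFactorial_cons]
    exact Nat.mul_pos (Nat.factorial_pos _) (Nat.mul_pos c.degFactorial_pos r.degFactorial_pos)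

theorem suffixProduct_pos : ∀ F : PlaneForest, 0 < F.suffixProduct
  | nil => one_pos
  | cons _ r => Nat.mul_pos (Nat.succ_pos _) r.suffixProduct_pos

/-- With `s` nodes below the roots on the stack, the number of waiting nodes when a node becomes
active is its exponent, so the powers of `1 + t` add up to `exponentSum`. The binomial coefficients
telescope. -/
theorem runWeight_degSeq_append (t : ℝ) : ∀ (F : PlaneForest) (ds : List ℕ) (s u : ℕ),
    F.numNodes - F.numTrees ≤ u →
    runWeight t (F.degSeq ++ ds) (F.numTrees + s) u =
      u.factorial / ((u - (F.numNodes - F.numTrees)).factorial * F.degFactorial) *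
        t ^ (F.numNodes - F.numTrees) * (1 + t) ^ F.exponentSum s *
        runWeight t ds s (u - (F.numNodes - F.numTrees))
  | nil, ds, s, u, _ => by
    have : (u.factorial : ℝ) ≠ 0 := by exact_mod_cast u.factorial_ne_zero
    simp [degSeq, numTrees, numNodes, degFactorial, exponentSum, this]
  | cons c r, ds, s, u, h => by
    have hc := c.numTrees_le_numNodes
    have hr := r.numTrees_le_numNodes
    have hN : (cons c r).numNodes - (cons c r).numTrees =
        c.numTrees + (c.numNodes - c.numTrees) + (r.numNodes - r.numTrees) := by
      simp only [numNodes, numTrees]; omega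
    rw [hN] at h ⊢
    have h₁ := runWeight_degSeq_append t c (r.degSeq ++ ds) (r.numTrees + s) (u - c.numTrees)
      (by omega)
    have h₂ := runWeight_degSeq_append t r ds s (u - c.numTrees - (c.numNodes - c.numTrees))
      (by omega)
    generalize c.numNodes - c.numTrees = a at h h₁ h₂ ⊢
    generalize r.numNodes - r.numTrees = b at h h₁ h₂ ⊢
    have e : u - (c.numTrees + a + b) = u - c.numTrees - a - b := by omega
    rw [degSeq, List.cons_append, List.append_assoc, numTrees,
      show r.numTrees + 1 + s = r.numTrees + s + 1 by omega, runWeight, h₁, h₂, exponentSum,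
      degFactorial_cons, Nat.cast_choose ℝ (show c.numTrees ≤ u by omega), add_comm s r.numTrees, e]
    have p₁ : ((u - c.numTrees).factorial : ℝ) ≠ 0 := by positivity
    have p₂ : ((u - c.numTrees - a).factorial : ℝ) ≠ 0 := by positivity
    generalize ((u - c.numTrees).factorial : ℝ) = U₁ at p₁ ⊢
    generalize ((u - c.numTrees - a).factorial : ℝ) = U₂ at p₂ ⊢
    generalize runWeight t ds s (u - c.numTrees - a - b) = W
    push_cast
    calc _ = (U₁ * U₁⁻¹) * (U₂ * U₂⁻¹) * (u.factorial / ((u - c.numTrees - a - b).factorial *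
          (c.numTrees.factorial * (c.degFactorial * r.degFactorial))) *
          t ^ (c.numTrees + a + b) * (1 + t) ^ (r.numTrees + s + c.exponentSum (r.numTrees + s) +
            r.exponentSum s) * W) := by ring
      _ = _ := by rw [mul_inv_cancel₀ p₁, mul_inv_cancel₀ p₂]; ring

/-- The root of each component is forced to be the largest node left. This costs a factor equal to
the number of nodes left, and these factors form `suffixProduct`. -/
theorem runWeight_degSeq (t : ℝ) : ∀ F : PlaneForest,
    runWeight t F.degSeq 0 F.numNodes = F.numNodes.factorial /
      (F.degFactorial * F.suffixProduct) * t ^ (F.numNodes - F.numTrees) *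
        (1 + t) ^ F.componentExponentSum
  | nil => by simp [degSeq, numNodes, runWeight, degFactorial, suffixProduct, componentExponentSum]
  | cons c r => by
    have hc := c.numTrees_le_numNodes
    have hr := r.numTrees_le_numNodes
    have h₁ := runWeight_degSeq_append t c r.degSeq 0 (c.numNodes + r.numNodes - c.numTrees)
      (by omega)
    have e : c.numNodes + r.numNodes - c.numTrees - (c.numNodes - c.numTrees) = r.numNodes := by
      omega
    have hN : c.numNodes + r.numNodes + 1 - (r.numTrees + 1) =
        c.numTrees + (c.numNodes - c.numTrees) + (r.numNodes - r.numTrees) := by omega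
    rw [e, runWeight_degSeq t r, add_zero] at h₁
    simp only [degSeq, numNodes, numTrees, runWeight, h₁, degFactorial_cons, suffixProduct,
      componentExponentSum, hN]
    rw [Nat.cast_choose ℝ (show c.numTrees ≤ c.numNodes + r.numNodes by omega), Nat.factorial_succ]
    have p₁ : ((c.numNodes + r.numNodes - c.numTrees).factorial : ℝ) ≠ 0 := by
      exact_mod_cast Nat.factorial_ne_zero _
    have p₂ : (r.numNodes.factorial : ℝ) ≠ 0 := by exact_mod_cast Nat.factorial_ne_zero _
    have p₃ : (c.numTrees.factorial : ℝ) ≠ 0 := by exact_mod_cast Nat.factorial_ne_zero _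
    have p₄ : (c.degFactorial : ℝ) ≠ 0 := by exact_mod_cast c.degFactorial_pos.ne'
    have p₅ : (r.degFactorial : ℝ) ≠ 0 := by exact_mod_cast r.degFactorial_pos.ne'
    have p₆ : (r.suffixProduct : ℝ) ≠ 0 := by exact_mod_cast r.suffixProduct_pos.ne'
    have p₇ : (c.numNodes + r.numNodes + 1 : ℝ) ≠ 0 := by positivity
    push_cast
    simp only [pow_add]
    field_simp

/-! ### Product formula for the volumes -/

theorem chainLength_range'_append {L : List ℕ} : ∀ {k j : ℕ}, (∀ g ∈ L.head?, g ≠ j + k + 2) →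
    chainLength (List.range' (j + 2) k ++ L) (j + 1) = k
  | 0, j, h => by
    cases L with
    | nil => rfl
    | cons g L =>
      have : g ≠ j + 1 + 1 := h g (by simp)
      simp [chainLength, this]
  | k + 1, j, h => by
    rw [List.range'_succ, List.cons_append, chainLength, if_pos ⟨by omega, rfl⟩,
      chainLength_range'_append (j := j + 1) fun g hg => by have := h g hg; omega]

theorem codeWeight_range'_append {q t : ℝ} (hq : 0 < q) {L : List ℕ} : ∀ {k j : ℕ},
    (k ≠ 0 → ∀ g ∈ L.head?, g ≠ j + k + 1) →
    codeWeight q t (List.range' (j + 1) k ++ L) =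
      (1 + t) ^ (∑ i ∈ Finset.range k, (j + i)) * t ^ k / (q ^ k * k.factorial) * codeWeight q t L
  | 0, j, _ => by simp
  | k + 1, j, h => by
    rw [List.range'_succ, List.cons_append, codeWeight, if_neg (by omega),
      chainLength_range'_append fun g hg => by have := h (by omega) g hg; omega,
      codeWeight_range'_append hq (j := j + 1) fun _ g hg => by have := h (by omega) g hg; omega,
      Finset.sum_range_succ', Nat.factorial_succ]
    have : ((k.factorial : ℕ) : ℝ) ≠ 0 := by exact_mod_cast Nat.factorial_ne_zero _
    have e : ∑ i ∈ Finset.range k, (j + (i + 1)) = ∑ i ∈ Finset.range k, (j + 1 + i) :=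
      Finset.sum_congr rfl fun i _ => by omega
    rw [e, add_zero, Nat.add_sub_cancel, pow_add, pow_succ t, pow_succ q]
    generalize ∑ i ∈ Finset.range k, (j + 1 + i) = S
    push_cast
    field_simp

/-- The roots of `F` are counted in `exponentSum` but not in `descCode`, as their block is handled
one level higher; the power of `1 + t` on the left supplies their share. -/
theorem codeWeight_descCode_append {q t : ℝ} (hq : 0 < q) : ∀ (F : PlaneForest) (j : ℕ)
    (L : List ℕ), (∀ g ∈ L.head?, g ≤ j + 1) →
    (1 + t) ^ (∑ i ∈ Finset.range F.numTrees, (j + i)) *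
        codeWeight q t (F.descCode (j + 1) ++ L) =
      (1 + t) ^ F.exponentSum j * t ^ (F.numNodes - F.numTrees) /
        (q ^ (F.numNodes - F.numTrees) * F.degFactorial) * codeWeight q t L
  | nil, j, L, _ => by simp [numTrees, descCode, exponentSum, numNodes, degFactorial, degSeq]
  | cons c r, j, L, h => by
    have hc := c.numTrees_le_numNodes
    have hr := r.numTrees_le_numNodes
    have hN : (cons c r).numNodes - (cons c r).numTrees =
        c.numTrees + (c.numNodes - c.numTrees) + (r.numNodes - r.numTrees) := by
      simp only [numNodes, numTrees]; omega
    have h₁ := head_descCode_append (F := r) h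
    have h₂ := head_descCode_append (F := c) (j := j + 1 + r.numTrees)
      (fun g hg => (h₁ g hg).trans (by omega))
    have e₁ : j + 1 + r.numTrees = j + r.numTrees + 1 := by omega
    rw [e₁] at h₂
    have ihc := codeWeight_descCode_append (q := q) (t := t) hq c (j + r.numTrees)
      (r.descCode (j + 1) ++ L) (fun g hg => (h₁ g hg).trans (by omega))
    have ihr := codeWeight_descCode_append (q := q) (t := t) hq r j L h
    rw [descCode, List.append_assoc, List.append_assoc, e₁,
      codeWeight_range'_append hq (fun hk g hg => by have := h₂ g hg; omega), numTrees,
      Finset.sum_range_succ, exponentSum, degFactorial_cons]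
    rw [show (cons c r).numNodes - (r.numTrees + 1) = (cons c r).numNodes - (cons c r).numTrees
      from rfl, hN]
    calc _ = (1 + t) ^ (j + r.numTrees) * (t ^ c.numTrees / (q ^ c.numTrees *
          c.numTrees.factorial)) * (1 + t) ^ (∑ i ∈ Finset.range r.numTrees, (j + i)) *
          ((1 + t) ^ (∑ i ∈ Finset.range c.numTrees, (j + r.numTrees + i)) *
            codeWeight q t (c.descCode (j + r.numTrees + 1) ++ (r.descCode (j + 1) ++ L))) := by
          rw [pow_add]; ring
      _ = (1 + t) ^ (j + r.numTrees) * (t ^ c.numTrees / (q ^ c.numTrees *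
          c.numTrees.factorial)) * ((1 + t) ^ c.exponentSum (j + r.numTrees) *
          t ^ (c.numNodes - c.numTrees) / (q ^ (c.numNodes - c.numTrees) * c.degFactorial)) *
          ((1 + t) ^ (∑ i ∈ Finset.range r.numTrees, (j + i)) *
            codeWeight q t (r.descCode (j + 1) ++ L)) := by
          rw [ihc]; ring
      _ = _ := by
          rw [ihr]
          push_cast
          ring

/-- Each cone contributes the reciprocal of its dimension, which is the number of nodes from its
component on. This is the same factor as for the graphs. -/
theorem codeWeight_codeTop {q t : ℝ} (hq : 0 < q) : ∀ F : PlaneForest,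
    codeWeight q t F.codeTop =
      (1 + t) ^ F.componentExponentSum * t ^ (F.numNodes - F.numTrees) /
        (q ^ (F.numNodes - F.numTrees) * F.degFactorial * F.suffixProduct)
  | nil => by simp [codeTop, codeWeight, componentExponentSum, numNodes, degFactorial, degSeq,
      suffixProduct]
  | cons c r => by
    have hc := c.numTrees_le_numNodes
    have hr := r.numTrees_le_numNodes
    have hN : c.numNodes + r.numNodes + 1 - (r.numTrees + 1) =
        c.numTrees + (c.numNodes - c.numTrees) + (r.numNodes - r.numTrees) := by omega
    have h₁ := head_descCode_append (F := c) (j := 1) (L := r.codeTop)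
      (fun g hg => by rw [r.head_codeTop hg]; omega)
    have h₂ := codeWeight_descCode_append (q := q) (t := t) hq c 0 r.codeTop
      (fun g hg => by rw [r.head_codeTop hg]; omega)
    have h₃ := codeWeight_range'_append (q := q) (t := t) hq (L := c.descCode 1 ++ r.codeTop)
      (k := c.numTrees) (j := 0) (fun hk g hg => by have := h₁ g hg; omega)
    rw [zero_add] at h₂ h₃
    rw [codeTop, codeWeight, if_pos rfl, List.length_append, length_code, length_codeTop, code,
      List.append_assoc, h₃]
    simp only [numNodes, numTrees, hN, degFactorial_cons, componentExponentSum, suffixProduct]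
    calc _ = 1 / ((c.numNodes + r.numNodes : ℕ) + 1 : ℝ) * (t ^ c.numTrees / (q ^ c.numTrees *
          c.numTrees.factorial)) * ((1 + t) ^ (∑ i ∈ Finset.range c.numTrees, (0 + i)) *
            codeWeight q t (c.descCode 1 ++ r.codeTop)) := by ring
      _ = _ := by
        rw [h₂, codeWeight_codeTop hq r]
        push_cast
        generalize (c.numNodes : ℝ) + r.numNodes + 1 = N
        ring

/-! #### The reduced degree sequence -/

/-- The sum `∑ (s + i) d_i` over the entries `d₁, d₂, …` of a list. -/
def weightedSum : ℕ → List ℕ → ℕ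
  | _, [] => 0
  | s, d :: l => (s + 1) * d + weightedSum (s + 1) l

theorem weightedSum_append : ∀ (s : ℕ) (l l' : List ℕ),
    weightedSum s (l ++ l') = weightedSum s l + weightedSum (s + l.length) l'
  | s, [], l' => by simp [weightedSum]
  | s, d :: l, l' => by
    rw [List.cons_append, weightedSum, weightedSum, weightedSum_append (s + 1) l l',
      List.length_cons, add_assoc ((s + 1) * d), add_right_comm s 1, add_assoc s l.length]

theorem weightedSum_eq : ∀ (s : ℕ) (l : List ℕ), weightedSum s l = weightedSum 0 l + s * l.sum
  | s, [] => by simp [weightedSum]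
  | s, d :: l => by
    rw [weightedSum, weightedSum, weightedSum_eq (s + 1) l, weightedSum_eq (0 + 1) l,
      List.sum_cons]
    ring

theorem sum_range_getD : ∀ (l : List ℕ) (s : ℕ),
    ∑ i ∈ Finset.range l.length, (s + i + 1) * l.getD i 0 = weightedSum s l
  | [], s => by simp [weightedSum]
  | d :: l, s => by
    rw [List.length_cons, Finset.sum_range_succ', weightedSum, ← sum_range_getD l (s + 1), add_comm]
    congr 1
    refine Finset.sum_congr rfl fun i _ => ?_
    rw [List.getD_cons_succ, show s + (i + 1) + 1 = s + 1 + i + 1 by omega]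

theorem sum_Icc_getD (l : List ℕ) :
    ∑ i ∈ Finset.Icc 1 l.length, (i : ℤ) * (l.getD (i - 1) 0 : ℤ) = weightedSum 0 l := by
  rw [← sum_range_getD]
  push_cast
  refine Finset.sum_bij' (fun i _ => i - 1) (fun i _ => i + 1) ?_ ?_ ?_ ?_ ?_ <;>
    simp only [Finset.mem_Icc, Finset.mem_range]
  · intros; omega
  · intros; omega
  · intros; omega
  · intros; omega
  · intro i hi
    have : ((i - 1 : ℕ) : ℤ) = i - 1 := by omega
    rw [this]
    ring

theorem exists_degSeq_cons_eq : ∀ c r : PlaneForest, ∃ l, (cons c r).degSeq = l ++ [0]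
  | nil, nil => ⟨[], rfl⟩
  | cons a b, nil => by
    obtain ⟨l, hl⟩ := exists_degSeq_cons_eq a b
    exact ⟨(cons a b).numTrees :: l, by rw [degSeq, hl]; simp [degSeq]⟩
  | c, cons a b => by
    obtain ⟨l, hl⟩ := exists_degSeq_cons_eq a b
    exact ⟨c.numTrees :: (c.degSeq ++ l), by rw [degSeq, hl]; simp⟩
termination_by c r => c.numNodes + r.numNodes
decreasing_by all_goals simp only [numNodes]; omega

theorem dropLast_append_zero (c : PlaneForest) :
    (c.numTrees :: c.degSeq).dropLast ++ [0] = c.numTrees :: c.degSeq := by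
  obtain ⟨l, hl⟩ := exists_degSeq_cons_eq c nil
  have h : (cons c nil).degSeq = c.numTrees :: c.degSeq := by simp [degSeq]
  rw [← h, hl, List.dropLast_concat]

theorem sum_dropLast (c : PlaneForest) : (c.numTrees :: c.degSeq).dropLast.sum = c.numNodes := by
  have h := congrArg List.sum c.dropLast_append_zero
  have := c.sum_degSeq_add_numTrees
  simp only [List.sum_append, List.sum_cons, List.sum_nil] at h
  omega

theorem length_dropLast (c : PlaneForest) :
    (c.numTrees :: c.degSeq).dropLast.length = c.numNodes := by
  rw [List.length_dropLast, List.length_cons, length_degSeq, Nat.add_sub_cancel]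

theorem length_reducedDegSeq : ∀ F : PlaneForest,
    F.reducedDegSeq.length + F.numTrees = F.numNodes
  | nil => rfl
  | cons c r => by
    have := length_reducedDegSeq r
    simp only [reducedDegSeq, List.length_append, length_dropLast, numNodes, numTrees]
    omega

theorem sum_reducedDegSeq : ∀ F : PlaneForest, F.reducedDegSeq.sum + F.numTrees = F.numNodes
  | nil => rfl
  | cons c r => by
    have := sum_reducedDegSeq r
    simp only [reducedDegSeq, List.sum_append, sum_dropLast, numNodes, numTrees]
    omega

theorem prod_factorial_reducedDegSeq : ∀ F : PlaneForest,
    (F.reducedDegSeq.map Nat.factorial).prod = F.degFactorial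
  | nil => rfl
  | cons c r => by
    have h := congrArg (fun l => (l.map Nat.factorial).prod) c.dropLast_append_zero
    simp only [List.map_append, List.prod_append, List.map_cons, List.prod_cons, List.map_nil,
      List.prod_nil, Nat.factorial_zero, mul_one] at h
    rw [reducedDegSeq, List.map_append, List.prod_append, h, prod_factorial_reducedDegSeq r,
      degFactorial_cons]
    simp only [degFactorial, mul_assoc]

/-- Activating a node of degree d changes the stack size by d - 1, so the stack sizes are partial
sums of the degree sequence, and summing them weights each degree by its position. Doubling and
passing to the integers avoids division and truncated subtraction. -/
theorem two_mul_exponentSum : ∀ (F : PlaneForest) (j : ℕ),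
    (2 * F.exponentSum j : ℤ) =
      2 * F.numNodes * j + F.numNodes * (F.numNodes - 1) - 2 * weightedSum 0 F.degSeq
  | nil, j => by simp [exponentSum, numNodes, degSeq, weightedSum]
  | cons c r, j => by
    have hc := two_mul_exponentSum c (j + r.numTrees)
    have hr := two_mul_exponentSum r j
    have h₁ : (c.degSeq.map (Nat.cast : ℕ → ℤ)).sum = c.numNodes - c.numTrees := by
      have := c.sum_degSeq_add_numTrees
      rw [← Nat.cast_list_sum]; omega
    have h₂ : (r.degSeq.map (Nat.cast : ℕ → ℤ)).sum = r.numNodes - r.numTrees := by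
      have := r.sum_degSeq_add_numTrees
      rw [← Nat.cast_list_sum]; omega
    rw [degSeq, weightedSum, weightedSum_append, weightedSum_eq (0 + 1),
      weightedSum_eq (0 + 1 + _), length_degSeq, exponentSum, numNodes]
    push_cast at hc ⊢
    rw [h₁, h₂]
    linear_combination hc + hr

/-- Erasing the final 0 of each component leaves as many entries as their sum. This balance makes
the shifts of position between components cancel. -/
theorem two_mul_componentExponentSum : ∀ F : PlaneForest,
    (2 * F.componentExponentSum : ℤ) =
      F.reducedDegSeq.length * (F.reducedDegSeq.length + 1) - 2 * weightedSum 0 F.reducedDegSeq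
  | nil => by simp [componentExponentSum, reducedDegSeq, weightedSum]
  | cons c r => by
    have hc := two_mul_exponentSum c 0
    have hr := two_mul_componentExponentSum r
    have h₁ : (c.degSeq.map (Nat.cast : ℕ → ℤ)).sum = c.numNodes - c.numTrees := by
      have := c.sum_degSeq_add_numTrees
      rw [← Nat.cast_list_sum]; omega
    have h₂ : (r.reducedDegSeq.map (Nat.cast : ℕ → ℤ)).sum = r.reducedDegSeq.length := by
      rw [← Nat.cast_list_sum]
      have h := r.length_reducedDegSeq
      have := r.sum_reducedDegSeq
      omega
    have h₃ := congrArg (fun l => ((weightedSum 0 l : ℕ) : ℤ)) c.dropLast_append_zero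
    simp only [weightedSum_append, weightedSum, weightedSum_eq (0 + 1) c.degSeq] at h₃
    push_cast at h₃ hc
    rw [h₁] at h₃
    rw [componentExponentSum, reducedDegSeq, weightedSum_append, List.length_append,
      length_dropLast, weightedSum_eq (0 + _)]
    push_cast
    rw [h₂]
    linear_combination hc + hr + 2 * h₃

theorem choose_two_sub_eq (F : PlaneForest) :
    (((F.reducedDegSeq.length + 1).choose 2 : ℕ) : ℤ) - weightedSum 0 F.reducedDegSeq =
      F.componentExponentSum := by
  have h := F.two_mul_componentExponentSum
  have h₃ : (F.reducedDegSeq.length + 1).choose 2 * 2 =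
      (F.reducedDegSeq.length + 1) * F.reducedDegSeq.length := by
    rw [Nat.choose_two_right, Nat.add_sub_cancel]
    exact Nat.div_mul_cancel (Nat.even_mul_pred_self _).two_dvd
  zify at h₃
  linarith

theorem prod_range_drop_treeSizes : ∀ F : PlaneForest,
    ∏ j ∈ Finset.range F.numTrees, (F.treeSizes.drop j).sum = F.suffixProduct
  | nil => rfl
  | cons c r => by
    have hsum : ∀ F : PlaneForest, F.treeSizes.sum = F.numNodes := by
      intro F
      induction F with
      | nil => rfl
      | cons c r _ ih => simp only [treeSizes, List.sum_cons, ih, numNodes]; omega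
    rw [numTrees, Finset.prod_range_succ', List.drop_zero, hsum, suffixProduct, mul_comm]
    simp only [treeSizes, List.drop_succ_cons, prod_range_drop_treeSizes r]

theorem prod_Icc_drop_treeSizes (c r : PlaneForest) :
    ∏ j ∈ Finset.Icc 2 (cons c r).numTrees, (((cons c r).treeSizes.drop (j - 1)).sum : ℝ) =
      r.suffixProduct := by
  rw [← prod_range_drop_treeSizes, Nat.cast_prod]
  refine Finset.prod_bij' (fun i _ => i - 2) (fun i _ => i + 2) ?_ ?_ ?_ ?_ ?_ <;>
    simp only [Finset.mem_Icc, Finset.mem_range, numTrees]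
  · intros; omega
  · intros; omega
  · intros; omega
  · intros; omega
  · intro i hi
    rw [treeSizes, show i - 1 = i - 2 + 1 by omega, List.drop_succ_cons]

end PlaneForest

/-! ### The theorem -/

theorem sum_planeSearchForest_closed_form (n : ℕ) (q t : ℝ)
    (F : PlaneForestOn (n + 1)) :
    ∑ G ∈ Finset.univ.filter (fun G : SimpleGraph (Fin (n + 1)) => planeSearchForest G = F.1),
      q ^ (numComponents G - 1) * t ^ numEdges G =
    ((n.factorial : ℝ) / ((F.1.reducedDegSeq.map Nat.factorial).prod : ℝ)) /
        (∏ j ∈ Finset.Icc 2 F.1.numTrees, ((F.1.treeSizes.drop (j - 1)).sum : ℝ)) *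
      q ^ (F.1.numTrees - 1) * t ^ F.1.reducedDegSeq.sum *
      (1 + t) ^ (((n + 2 - F.1.numTrees).choose 2 : ℤ) -
        ∑ i ∈ Finset.Icc 1 (n + 1 - F.1.numTrees),
          (i : ℤ) * (F.1.reducedDegSeq.getD (i - 1) 0 : ℤ)) := by
  obtain ⟨F, hF⟩ := F
  have hle := F.numTrees_le_numNodes
  have hlen : F.reducedDegSeq.length = n + 1 - F.numTrees := by
    have := F.length_reducedDegSeq; omega
  have hsum : F.reducedDegSeq.sum = n + 1 - F.numTrees := by
    have := F.sum_reducedDegSeq; omega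
  have hexp : (((n + 2 - F.numTrees).choose 2 : ℤ) - ∑ i ∈ Finset.Icc 1 (n + 1 - F.numTrees),
      (i : ℤ) * (F.reducedDegSeq.getD (i - 1) 0 : ℤ)) = F.componentExponentSum := by
    rw [← hlen, PlaneForest.sum_Icc_getD, ← F.choose_two_sub_eq, hlen]
    congr 3
    omega
  have hrun := F.runWeight_degSeq t
  rw [hF] at hrun
  simp only
  rw [sum_planeSearchForest_eq, Fintype.card_fin, hrun, hexp, zpow_natCast, hsum,
    PlaneForest.prod_factorial_reducedDegSeq]
  cases F with
  | nil => simp [PlaneForest.numNodes] at hF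
  | cons c r =>
    rw [PlaneForest.prod_Icc_drop_treeSizes, PlaneForest.suffixProduct, hF, Nat.factorial_succ]
    have hn : ((n : ℝ) + 1) ≠ 0 := by positivity
    push_cast
    generalize (n : ℝ) + 1 = N at hn ⊢
    calc _ = N * N⁻¹ * (n.factorial / (PlaneForest.cons c r).degFactorial / r.suffixProduct *
          q ^ ((PlaneForest.cons c r).numTrees - 1) *
          t ^ (n + 1 - (PlaneForest.cons c r).numTrees) *
          (1 + t) ^ (PlaneForest.cons c r).componentExponentSum) := by ring
      _ = _ := by rw [mul_inv_cancel₀ hn, one_mul]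

theorem volume_eq_sum_planeSearchForest (n : ℕ) (q t : ℝ) (hq : 0 < q) (ht : 0 < t)
    (F : PlaneForestOn (n + 1)) :
    (n.factorial : ℝ) * MeasureTheory.volume.real (forestPolytope q t F) =
      ∑ G ∈ Finset.univ.filter (fun G : SimpleGraph (Fin (n + 1)) => planeSearchForest G = F.1),
        q ^ (numComponents G - 1) * t ^ numEdges G := by
  have hcw := PlaneForest.codeWeight_codeTop (t := t) hq F.1
  rw [codeTop_eq_cons, codeWeight, if_pos rfl, length_tail_codeTop] at hcw
  have hn : ((n : ℝ) + 1) ≠ 0 := by positivity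
  -- The weight of the full code contains a factor 1/(n+1) for the first root, which is not a
  -- coordinate of the polytope. Moving it to the other side turns n! into (n+1)!.
  rw [one_div, inv_mul_eq_iff_eq_mul₀ hn] at hcw
  have hrun := F.1.runWeight_degSeq t
  have hle := F.1.numTrees_le_numNodes
  rw [F.2] at hrun hcw hle
  have hpos : 1 ≤ F.1.numTrees := by
    obtain ⟨F, hF⟩ := F
    cases F with
    | nil => simp [PlaneForest.numNodes] at hF
    | cons c r => simp [PlaneForest.numTrees]
  have hpow : q ^ n = q ^ (F.1.numTrees - 1) * q ^ (n + 1 - F.1.numTrees) := by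
    rw [← pow_add]; congr 1; omega
  rw [volume_real_forestPolytope hq ht, sum_planeSearchForest_eq, Fintype.card_fin, hrun, hcw, hpow,
    Nat.factorial_succ]
  have hq' : q ^ (n + 1 - F.1.numTrees) ≠ 0 := by positivity
  push_cast
  calc _ = q ^ (n + 1 - F.1.numTrees) * (q ^ (n + 1 - F.1.numTrees))⁻¹ * (q ^ (F.1.numTrees - 1) *
        (((n : ℝ) + 1) * n.factorial / (F.1.degFactorial * F.1.suffixProduct) *
          t ^ (n + 1 - F.1.numTrees) * (1 + t) ^ F.1.componentExponentSum)) := by ring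
    _ = _ := by rw [mul_inv_cancel₀ hq', one_mul]

theorem numComponents_top (n : ℕ) : numComponents (⊤ : SimpleGraph (Fin (n + 1))) = 1 := by
  rw [numComponents, Nat.card_eq_one_iff_unique]
  have := (SimpleGraph.connected_top (V := Fin (n + 1)))
  exact ⟨this.preconnected.subsingleton_connectedComponent,
    ⟨(⊤ : SimpleGraph (Fin (n + 1))).connectedComponentMk 0⟩⟩

theorem theorem7p3 (n : ℕ) (q t : ℝ) (hq : 0 < q) (hq1 : q ≤ 1) (ht : 0 < t) :
    (∀ F : PlaneForestOn (n + 1),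
      IsBoundedPolytope (forestPolytope q t F) ∧
      (n.factorial : ℝ) * MeasureTheory.volume.real (forestPolytope q t F) =
        ∑ G ∈ Finset.univ.filter
            (fun G : SimpleGraph (Fin (n + 1)) => planeSearchForest G = F.1),
          q ^ (numComponents G - 1) * t ^ numEdges G ∧
      ∑ G ∈ Finset.univ.filter
            (fun G : SimpleGraph (Fin (n + 1)) => planeSearchForest G = F.1),
          q ^ (numComponents G - 1) * t ^ numEdges G =
        ((n.factorial : ℝ) / ((F.1.reducedDegSeq.map Nat.factorial).prod : ℝ)) /
            (∏ j ∈ Finset.Icc 2 F.1.numTrees, ((F.1.treeSizes.drop (j - 1)).sum : ℝ)) *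
          q ^ (F.1.numTrees - 1) * t ^ F.1.reducedDegSeq.sum *
          (1 + t) ^ (((n + 2 - F.1.numTrees).choose 2 : ℤ) -
            ∑ i ∈ Finset.Icc 1 (n + 1 - F.1.numTrees),
              (i : ℤ) * (F.1.reducedDegSeq.getD (i - 1) 0 : ℤ))) ∧
    IsPolytopalSubdivision (tuttePolytope n q t)
      (fun F : PlaneForestOn (n + 1) => forestPolytope q t F) ∧
    (n.factorial : ℝ) * MeasureTheory.volume.real (tuttePolytope n q t) =
      ∑ G : SimpleGraph (Fin (n + 1)), q ^ (numComponents G - 1) * t ^ numEdges G ∧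
    ∑ G : SimpleGraph (Fin (n + 1)), q ^ (numComponents G - 1) * t ^ numEdges G =
      clusterPolynomial (⊤ : SimpleGraph (Fin (n + 1))) q t := by
  have hsub := isPolytopalSubdivision_forestPolytope hq hq1 ht n
  refine ⟨fun F => ⟨isBoundedPolytope_forestPolytope hq hq1 ht F,
    volume_eq_sum_planeSearchForest n q t hq ht F,
    sum_planeSearchForest_closed_form n q t F⟩, hsub, ?_, ?_⟩
  · have := hsub.finite
    have := Fintype.ofFinite (PlaneForestOn (n + 1))
    rw [hsub.volume_real_eq, Finset.mul_sum]
    simp only [volume_eq_sum_planeSearchForest n q t hq ht]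
    -- Every graph belongs to exactly one search forest, so the cell volumes add up to the sum over
    -- all graphs.
    rw [← Finset.sum_fiberwise Finset.univ (fun G : SimpleGraph (Fin (n + 1)) =>
      (⟨planeSearchForest G, by rw [numNodes_planeSearchForest, Fintype.card_fin]⟩ :
        PlaneForestOn (n + 1)))]
    simp only [Subtype.ext_iff]
  · rw [clusterPolynomial, numComponents_top]
    refine Finset.sum_congr ?_ fun _ _ => rfl
    ext G
    simp
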